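/- Let $\Omega=(a,b)$ be a bounded open interval, $0<\sigma\le 1/2$, $\beta\in\mathbb R$, $T>0$ and $f(\rho)=\beta\rho^\sigma$ for $\rho\ge 0$. Let $V\in H^1(\Omega)$ be real-valued and let $\psi\in C([0,T];H^1_0(\Omega))$ be complex-valued and solve $$ i\,\partial_t\psi=-\partial_{xx}\psi+V\psi+f(|\psi|^2)\psi \quad\text{on } \Omega\times[0,T] $$ in the sense of $H^{-1}(\Omega)$, with initial value $\psi_0=\psi(\cdot,0)$; functions in $H^1(\Omega)$ are identified with their continuous representatives on $[a,b]$. For a positive integer $N$ put $h=(b-a)/N$, $x_j=a+jh$ and $\mu_l=\pi l/(b-a)$. For a grid function $w=(w_0,\dots,w_N)$ let $$ \widetilde w_l=\frac 2N\sum_{j=1}^{N-1}w_j\sin\Big(\frac{j\pi l}{N}\Big),\qquad (I_Nw)(x)=\sum_{l=1}^{N-1}\widetilde w_l\sin(\mu_l(x-a)). $$ For a time step $\tau>0$ and $t_k=k\tau$, the Lie–Trotter time-splitting sine pseudospectral (TSSP) approximation is $\psi^0_j=\psi_0(x_j)$ and, for $k\ge 0$ and $0\le j\le N$, $$ \psi^{(1)}_j=e^{-i\tau(V(x_j)+f(|\psi^k_j|^2))}\psi^k_j,\qquad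 \psi^{k+1}_j=\sum_{l=1}^{N-1}e^{-i\tau\mu_l^2}\,\widetilde{(\psi^{(1)})}_l\,\sin(\mu_l(x_j-a)). $$ Then for all $0<\tau<1$ and all $N$ with $0<h<1$, $$ \|\psi(\cdot,t_k)-I_N\psi^k\|_{L^2(\Omega)}\le C\,(\tau^{1/2}+h),\qquad 0\le k\le T/\tau, $$ where $C$ is independent of $\tau$, $h$ and $k$; it depends only on $a$, $b$, $\beta$, $\sigma$, $T$ and an upper bound $M$ for $\|V\|_{H^1(\Omega)}$ and $\sup_{t\in[0,T]}\|\psi(\cdot,t)\|_{H^1(\Omega)}$. -/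

import Mathlib

open MeasureTheory Set Filter Topology
open scoped ContDiff

noncomputable section

namespace NLS

section Sobolev

variable {E : Type*} [NormedAddCommGroup E] [NormedSpace ℝ E]

/-- Real test functions on the open interval `(a, b)`: the space `C_c^∞(a, b)`. -/
def IsTestFunction (a b : ℝ) (φ : ℝ → ℝ) : Prop :=
  ContDiff ℝ ∞ φ ∧ HasCompactSupport φ ∧ tsupport φ ⊆ Ioo a b

/-- `g ∈ L²(a, b)` is the weak derivative of `u` on `(a, b)`. -/
def HasWeakDerivL2 (a b : ℝ) (u g : ℝ → E) : Prop :=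
  MemLp g 2 (volume.restrict (Ioo a b)) ∧
    ∀ φ : ℝ → ℝ, IsTestFunction a b φ →
      ∫ x in a..b, deriv φ x • u x = - ∫ x in a..b, φ x • g x

/-- `u` is a function of `H¹(a, b)`: it is square integrable with a square integrable weak
derivative. Every class in `H¹(a, b)` has exactly one representative that is continuous on
`[a, b]`; point values of `H¹` functions always refer to that representative, so `u` itself
is required to be this representative. Values of `u` outside `[a, b]` play no role. -/
structure MemH1 (a b : ℝ) (u : ℝ → E) : Prop where
  continuousOn : ContinuousOn u (Icc a b)
  memLp : MemLp u 2 (volume.restrict (Ioo a b))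
  exists_weakDeriv : ∃ g : ℝ → E, HasWeakDerivL2 a b u g

/-- `u ∈ H¹₀(a, b)`: an `H¹` function with vanishing trace at both end points. -/
structure MemH10 (a b : ℝ) (u : ℝ → E) : Prop extends MemH1 a b u where
  left_eq_zero : u a = 0
  right_eq_zero : u b = 0

open Classical in
/-- The weak derivative of an `H¹` function (unique up to a null set of `(a, b)`); the value for
functions without a square integrable weak derivative is irrelevant. -/
def weakDeriv (a b : ℝ) (u : ℝ → E) : ℝ → E :=
  if h : ∃ g : ℝ → E, HasWeakDerivL2 a b u g then h.choose else 0

/-- The norm of `L²(a, b)`. -/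
def l2Norm (a b : ℝ) (u : ℝ → E) : ℝ :=
  Real.sqrt (∫ x in a..b, ‖u x‖ ^ 2)

/-- The norm of `H¹(a, b)`. -/
def h1Norm (a b : ℝ) (u : ℝ → E) : ℝ :=
  Real.sqrt (l2Norm a b u ^ 2 + l2Norm a b (weakDeriv a b u) ^ 2)

/-- `ψ ∈ C([0, T]; H¹₀(a, b))`, where `ψ t` is the spatial function at time `t`. -/
def ContinuousIntoH10 (a b T : ℝ) (ψ : ℝ → ℝ → E) : Prop :=
  (∀ t ∈ Icc 0 T, MemH10 a b (ψ t)) ∧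
    ∀ t ∈ Icc 0 T,
      Tendsto (fun s => h1Norm a b (fun x => ψ s x - ψ t x)) (𝓝[Icc 0 T] t) (𝓝 0)

end Sobolev

/-- The nonlinearity `f(ρ) = β ρ^σ`, used for `ρ ≥ 0`. -/
def nonlin (β σ ρ : ℝ) : ℝ := β * ρ ^ σ

/-- `ψ` solves `i ∂ₜψ = -∂ₓₓψ + V ψ + f(|ψ|²) ψ` on `(a, b) × [0, T]` in the sense of
`H⁻¹(a, b)`, the dual of `H¹₀(a, b)`: the equation, multiplied by `-i`, holds at every time when
paired with any `φ ∈ H¹₀(a, b)` (one-sided time derivatives at `0` and `T`). The homogeneous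
Dirichlet condition is part of `ψ t ∈ H¹₀(a, b)`, which is required separately. -/
def SolvesNLS (a b β σ T : ℝ) (V : ℝ → ℝ) (ψ : ℝ → ℝ → ℂ) : Prop :=
  ∀ φ : ℝ → ℂ, MemH10 a b φ → ∀ t ∈ Icc 0 T,
    HasDerivWithinAt (fun s => ∫ x in a..b, ψ s x * φ x)
      (-Complex.I *
        ((∫ x in a..b, weakDeriv a b (ψ t) x * weakDeriv a b φ x) +
          ∫ x in a..b, ((V x + nonlin β σ (‖ψ t x‖ ^ 2) : ℝ) : ℂ) * ψ t x * φ x))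
      (Icc 0 T) t

/-- The mesh size `h = (b - a) / N`. -/
def meshSize (a b : ℝ) (N : ℕ) : ℝ := (b - a) / N

/-- The grid points `x_j = a + j h`. -/
def gridPoint (a b : ℝ) (N j : ℕ) : ℝ := a + j * meshSize a b N

/-- The frequencies `μ_l = π l / (b - a)`. -/
def freq (a b : ℝ) (l : ℕ) : ℝ := Real.pi * l / (b - a)

/-- The discrete sine coefficient
`(2 / N) ∑_{j = 1}^{N - 1} w_j sin(j π l / N)` of a grid function `w`. A grid function is given as
a sequence of which only the entries `0, …, N` are meaningful. -/
def sineCoeff (N : ℕ) (w : ℕ → ℂ) (l : ℕ) : ℂ :=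
  2 / (N : ℂ) * ∑ j ∈ Finset.Ico 1 N, w j * (Real.sin (j * Real.pi * l / N) : ℂ)

/-- The sine interpolation `I_N w`. -/
def sineInterp (a b : ℝ) (N : ℕ) (w : ℕ → ℂ) (x : ℝ) : ℂ :=
  ∑ l ∈ Finset.Ico 1 N, sineCoeff N w l * (Real.sin (freq a b l * (x - a)) : ℂ)

/-- The pointwise substep
`ψ_j ↦ exp(-i τ (V(x_j) + f(|ψ_j|²))) ψ_j`. -/
def potentialStep (a b β σ : ℝ) (V : ℝ → ℝ) (τ : ℝ) (N : ℕ) (w : ℕ → ℂ) (j : ℕ) : ℂ :=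
  Complex.exp (-Complex.I *
    ((τ * (V (gridPoint a b N j) + nonlin β σ (‖w j‖ ^ 2)) : ℝ) : ℂ)) * w j

/-- The substep of the free equation in sine space, evaluated on the grid:
`w ↦ ∑_{l = 1}^{N - 1} exp(-i τ μ_l²) w̃_l sin(μ_l (x_j - a))`. -/
def kineticStep (a b τ : ℝ) (N : ℕ) (w : ℕ → ℂ) (j : ℕ) : ℂ :=
  ∑ l ∈ Finset.Ico 1 N,
    Complex.exp (-Complex.I * ((τ * freq a b l ^ 2 : ℝ) : ℂ)) * sineCoeff N w l *
      (Real.sin (freq a b l * (gridPoint a b N j - a)) : ℂ)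

/-- The Lie-Trotter time-splitting sine pseudospectral method: `tssp … ψ₀ τ N k j` is the
approximation `ψ_j^k` of `ψ(x_j, k τ)`. -/
def tssp (a b β σ : ℝ) (V : ℝ → ℝ) (ψ₀ : ℝ → ℂ) (τ : ℝ) (N : ℕ) : ℕ → ℕ → ℂ
  | 0 => fun j => ψ₀ (gridPoint a b N j)
  | k + 1 => kineticStep a b τ N
      (potentialStep a b β σ V τ N (tssp a b β σ V ψ₀ τ N k))

end NLS

end

/-!
The error is measured in sine coefficients. Let `c(t)` be the vector of the first `N - 1` sine
coefficients of `ψ(t)` and `d^k` the discrete sine coefficients of the numerical solution. Testing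
the equation with `sin(μ_l (x - a))` shows that, in the interaction picture
`Z(r) = exp(i r μ²) c(t + r)`, one has `Z' = -i exp(i r μ²) g(t + r)`, where `g` are the coefficients of the source term
`G(ψ) = (V + f(|ψ|²)) ψ` (`SolvesNLS.hasDerivWithinAt_fourierVec`). The mean value inequality then
plays the role of Duhamel's formula (`norm_freeFlow_sub_add_le`), and only the estimate
`exp(i r μ²) g(t + r) = g(t) + O(√τ + h)` is needed (`norm_freeFlow_source_sub_le`). It holds
because `G` maps bounded sets of `H¹₀` to bounded sets of `H¹₀` (this uses `H¹ ⊆ L∞` and the local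
Lipschitz continuity of `z ↦ |z|^{2σ} z`) and because `|exp(i r μ²) - 1|² ≤ 2 r μ²`.

On the numerical side, the grid function `w` of the truncated sine series of `ψ(t_k)` is bounded,
and on it the pointwise substep agrees with an Euler step up to `O(τ (τ + h))`
(`norm_sineVec_phaseFlow_sub_add_le`). The substep is moreover Lipschitz continuous with constant
`1 + O(τ)` as soon as one of its two arguments is bounded (`norm_phaseFlow_sub_le`). This is where
`2σ ≤ 1` enters: the increment of `|z|^{2σ}` times the smaller modulus is controlled by the smaller
modulus, by concavity. Therefore no a priori bound on the numerical solution is needed. The free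
substep is unitary, so that the local error `O(τ (√τ + h))` sums up to `O(√τ + h)`
(`norm_fourierVec_sub_tssp_succ_le`, `le_exp_mul_of_le_one_add_mul`).

The spatial estimates all rest on one fact, `integral_sq_norm_sub_gridVec_le`: sine interpolation
converges with first order in `L²` for functions in `H¹₀`. Its proof compares discrete and
continuous `H¹` seminorms of sine polynomials (Parseval and Jordan's inequality) and applies the
Poincaré inequality on the cells of the grid. The truncated sine series is a best approximation, so
it is at least as good as the interpolant and completeness of the sines is not used. Membership in
`H¹` enters only through the increment bound `HasEnergyDensity`.
-/

noncomputable section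

namespace NLS

/-! ### Weak derivatives in one dimension -/

section SobolevTools

variable {E : Type*} [NormedAddCommGroup E] [NormedSpace ℝ E]

theorem absolutelyContinuousOnInterval_integral {g : ℝ → E} {a b : ℝ}
    (hg : IntervalIntegrable g volume a b) :
    AbsolutelyContinuousOnInterval (fun x => ∫ t in a..x, g t) a b := by
  have h := hg.norm.absolutelyContinuousOnInterval_intervalIntegral (c := a) (by simp)
  rw [absolutelyContinuousOnInterval_iff] at h ⊢
  intro ε hε
  obtain ⟨δ, hδ, h⟩ := h ε hε
  refine ⟨δ, hδ, fun I hI hlt => lt_of_le_of_lt (Finset.sum_le_sum fun i hi => ?_) (h I hI hlt)⟩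
  have hmem := hI.1 i hi
  have hint : ∀ z ∈ uIcc a b, IntervalIntegrable g volume a z := fun z hz =>
    hg.mono_set (uIcc_subset_uIcc left_mem_uIcc hz)
  rw [dist_eq_norm, dist_eq_norm,
    intervalIntegral.integral_interval_sub_left (hint _ hmem.1) (hint _ hmem.2),
    intervalIntegral.integral_interval_sub_left (hint _ hmem.1).norm (hint _ hmem.2).norm,
    Real.norm_eq_abs]
  exact intervalIntegral.norm_integral_le_abs_integral_norm

/-- Integration by parts of a `C¹` function against the primitive of an integrable function. -/
theorem integral_smul_eq_smul_integral_sub [CompleteSpace E] {φ φ' : ℝ → ℝ} {g : ℝ → E} {a b : ℝ}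
    (hφ : ∀ x, HasDerivAt φ (φ' x) x) (hφ' : Continuous φ')
    (hg : IntervalIntegrable g volume a b) :
    ∫ x in a..b, φ x • g x
      = φ b • (∫ x in a..b, g x) - ∫ x in a..b, φ' x • ∫ t in a..x, g t := by
  have hφc : Continuous φ := continuous_iff_continuousAt.2 fun x => (hφ x).continuousAt
  have hφ1 : ContDiff ℝ 1 φ := by
    rw [contDiff_one_iff_deriv]
    exact ⟨fun x => (hφ x).differentiableAt, by
      rwa [show deriv φ = φ' from funext fun x => (hφ x).deriv]⟩
  have hG := absolutelyContinuousOnInterval_integral hg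
  have h1 : IntervalIntegrable (fun x => φ x • g x) volume a b :=
    hg.continuousOn_smul hφc.continuousOn
  have h2 : IntervalIntegrable (fun x => φ' x • ∫ t in a..x, g t) volume a b :=
    (hφ'.continuousOn.smul hG.continuousOn).intervalIntegrable
  -- the difference of the two sides, as a function of the upper limit, is absolutely continuous
  -- with zero derivative almost everywhere
  have hac := ((hφ1.contDiffOn.absolutelyContinuousOnInterval (a := a) (b := b)).smul hG).sub
    ((absolutelyContinuousOnInterval_integral h1).add
      (absolutelyContinuousOnInterval_integral h2))
  obtain ⟨C, hC⟩ := hac.const_of_ae_hasDerivAt_zero (by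
    filter_upwards [hg.ae_hasDerivAt_integral, h1.ae_hasDerivAt_integral,
      h2.ae_hasDerivAt_integral] with x hx1 hx2 hx3 hx
    have d := ((hφ x).smul (hx1 hx a left_mem_uIcc)).sub
      ((hx2 hx a left_mem_uIcc).add (hx3 hx a left_mem_uIcc))
    simpa using d)
  have ha := hC a left_mem_uIcc
  have hb := hC b right_mem_uIcc
  simp only [Pi.sub_apply, Pi.add_apply, Pi.smul_apply', intervalIntegral.integral_same, smul_zero,
    add_zero, sub_zero] at ha hb
  rw [← ha, sub_eq_zero] at hb
  rw [hb, add_sub_cancel_right]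

theorem IsTestFunction.eq_zero {a b : ℝ} {φ : ℝ → ℝ} (h : IsTestFunction a b φ) {x : ℝ}
    (hx : x ∉ Ioo a b) : φ x = 0 :=
  image_eq_zero_of_notMem_tsupport fun hx' => hx (h.2.2 hx')

/-- A test function of integral zero is the derivative of a test function. -/
theorem IsTestFunction.exists_deriv_eq {a b : ℝ} {θ : ℝ → ℝ} (h : IsTestFunction a b θ)
    (h0 : ∫ x in a..b, θ x = 0) : ∃ φ, IsTestFunction a b φ ∧ deriv φ = θ := by
  have hd : ∀ x, HasDerivAt (fun x => ∫ t in a..x, θ t) (θ x) x := fun x =>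
    intervalIntegral.integral_hasDerivAt_right (h.1.continuous.intervalIntegrable _ _)
      (h.1.continuous.stronglyMeasurableAtFilter _ _) h.1.continuous.continuousAt
  have hde : deriv (fun x => ∫ t in a..x, θ t) = θ := funext fun x => (hd x).deriv
  rcases (tsupport θ).eq_empty_or_nonempty with he | hne
  · have hz : θ = 0 := by
      rwa [tsupport_eq_empty_iff] at he
    refine ⟨0, ⟨contDiff_const, HasCompactSupport.zero, ?_⟩, ?_⟩
    · rw [tsupport_eq_empty_iff.2 rfl]
      exact empty_subset _
    · rw [hz]; ext x; simp
  have hcomp : IsCompact (tsupport θ) := h.2.1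
  obtain ⟨p, hp, hpl⟩ := hcomp.exists_isLeast hne
  obtain ⟨q, hq, hql⟩ := hcomp.exists_isGreatest hne
  have hzl : ∀ x < p, θ x = 0 := fun x hx =>
    image_eq_zero_of_notMem_tsupport fun hx' => absurd (hpl hx') (not_le.2 hx)
  have hzr : ∀ x, q < x → θ x = 0 := fun x hx =>
    image_eq_zero_of_notMem_tsupport fun hx' => absurd (hql hx') (not_le.2 hx)
  have hap := (h.2.2 hp).1
  have hqb := (h.2.2 hq).2
  have hsupp : Function.support (fun x => ∫ t in a..x, θ t) ⊆ Icc p q := by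
    intro x hx
    by_contra hx'
    apply hx
    rw [mem_Icc, not_and_or, not_le, not_le] at hx'
    rcases hx' with hx' | hx'
    · refine intervalIntegral.integral_zero_ae (ae_of_all _ fun t ht => hzl t ?_)
      exact lt_of_le_of_lt ht.2 (max_lt hap hx')
    · have h2 : ∫ t in x..b, θ t = 0 := by
        refine intervalIntegral.integral_zero_ae (ae_of_all _ fun t ht => hzr t ?_)
        exact lt_of_le_of_lt (le_min hx'.le hqb.le) ht.1
      have h3 := intervalIntegral.integral_add_adjacent_intervals (μ := volume) (f := θ)
        (h.1.continuous.intervalIntegrable a x) (h.1.continuous.intervalIntegrable x b)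
      simpa [h2, h0] using h3
  have hts : tsupport (fun x => ∫ t in a..x, θ t) ⊆ Icc p q := closure_minimal hsupp isClosed_Icc
  refine ⟨_, ⟨?_, ?_, hts.trans fun x hx => ⟨hap.trans_le hx.1, hx.2.trans_lt hqb⟩⟩, hde⟩
  · rw [contDiff_infty_iff_deriv, hde]
    exact ⟨fun x => (hd x).differentiableAt, h.1⟩
  · exact isCompact_Icc.of_isClosed_subset (isClosed_tsupport _) hts

theorem intervalIntegrable_of_memLp {F : Type*} [NormedAddCommGroup F] {a b : ℝ} {g : ℝ → F}
    (h : MemLp g 2 (volume.restrict (Ioo a b))) (hab : a ≤ b) : IntervalIntegrable g volume a b := by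
  rw [intervalIntegrable_iff_integrableOn_Ioo_of_le hab]
  exact h.integrable (by norm_num)

theorem exists_isTestFunction_integral_eq_one {a b : ℝ} (hab : a < b) :
    ∃ η, IsTestFunction a b η ∧ ∫ x in a..b, η x = 1 := by
  let f : ContDiffBump ((a + b) / 2) := ⟨(b - a) / 8, (b - a) / 4, by linarith, by linarith⟩
  have hs : tsupport (f.normed volume) ⊆ Ioo a b := by
    rw [f.tsupport_normed_eq, Real.closedBall_eq_Icc]
    intro x hx
    simp only [f, mem_Icc] at hx
    exact ⟨by linarith [hx.1], by linarith [hx.2]⟩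
  refine ⟨f.normed volume, ⟨f.contDiff_normed, f.hasCompactSupport_normed, hs⟩, ?_⟩
  rw [intervalIntegral.integral_of_le hab.le, setIntegral_eq_integral_of_forall_compl_eq_zero]
  · exact f.integral_normed
  · intro x hx
    exact image_eq_zero_of_notMem_tsupport fun hx' => hx (Ioo_subset_Ioc_self (hs hx'))

theorem IsTestFunction.integral_smul_eq {a b : ℝ} {φ : ℝ → ℝ} (h : IsTestFunction a b φ)
    (hab : a ≤ b) (g : ℝ → E) : ∫ x, φ x • g x = ∫ x in a..b, φ x • g x := by
  rw [intervalIntegral.integral_of_le hab, setIntegral_eq_integral_of_forall_compl_eq_zero]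
  intro x hx
  rw [h.eq_zero fun hx' => hx (Ioo_subset_Ioc_self hx'), zero_smul]

/-- The lemma of du Bois-Reymond for functions that are continuous up to the boundary. -/
theorem eq_left_of_integral_deriv_smul_eq_zero [CompleteSpace E] {a b : ℝ} (hab : a < b) {w : ℝ → E}
    (hw : ContinuousOn w (Icc a b))
    (h : ∀ φ, IsTestFunction a b φ → ∫ x in a..b, deriv φ x • w x = 0) :
    ∀ x ∈ Icc a b, w x = w a := by
  obtain ⟨η, hη, hη1⟩ := exists_isTestFunction_integral_eq_one hab
  set c : E := ∫ x in a..b, η x • w x with hc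
  have hwi : IntervalIntegrable w volume a b := by
    apply ContinuousOn.intervalIntegrable
    rwa [uIcc_of_le hab.le]
  have hsm : ∀ φ : ℝ → ℝ, Continuous φ → IntervalIntegrable (fun x => φ x • w x) volume a b :=
    fun φ hφ => hwi.continuousOn_smul hφ.continuousOn
  have hae : ∀ᵐ x, x ∈ Ioo a b → w x - c = 0 := by
    refine isOpen_Ioo.ae_eq_zero_of_integral_contDiff_smul_eq_zero ?_ ?_
    · exact ((hw.mono Ioo_subset_Icc_self).sub continuousOn_const).locallyIntegrableOn
        measurableSet_Ioo
    intro χ h1 h2 h3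
    have hχ : IsTestFunction a b χ := ⟨h1, h2, h3⟩
    set m := ∫ x in a..b, χ x with hm
    have hθ : IsTestFunction a b (fun x => χ x - m * η x) := by
      refine ⟨h1.sub (contDiff_const.mul hη.1), ?_, ?_⟩
      · exact h2.sub hη.2.1.mul_left
      · refine (tsupport_sub _ _).trans (union_subset h3 ?_)
        exact (tsupport_mul_subset_right (f := fun _ => m)).trans hη.2.2
    obtain ⟨φ, hφ, hφe⟩ := hθ.exists_deriv_eq (by
      rw [intervalIntegral.integral_sub (h1.continuous.intervalIntegrable _ _)
        ((hη.1.continuous.intervalIntegrable _ _).const_mul m),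
        intervalIntegral.integral_const_mul, hη1, mul_one, ← hm, sub_self])
    have h0 := h φ hφ
    rw [hφe] at h0
    simp only [sub_smul, mul_smul] at h0
    rw [intervalIntegral.integral_sub (hsm χ h1.continuous) ((hsm η hη.1.continuous).continuousOn_smul continuousOn_const),
      intervalIntegral.integral_smul, ← hc] at h0
    rw [hχ.integral_smul_eq hab.le]
    have hχc : Continuous fun x => χ x • c := h1.continuous.smul continuous_const
    simp only [smul_sub]
    rw [intervalIntegral.integral_sub (hsm χ h1.continuous) (hχc.intervalIntegrable _ _),
      intervalIntegral.integral_smul_const, ← hm, h0]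
  have hIoo : EqOn w (fun _ => c) (Ioo a b) := by
    refine Measure.eqOn_open_of_ae_eq (μ := volume) ?_ isOpen_Ioo (hw.mono Ioo_subset_Icc_self)
      continuousOn_const
    rw [EventuallyEq, ae_restrict_iff' measurableSet_Ioo]
    filter_upwards [hae] with x hx hx'
    exact sub_eq_zero.1 (hx hx')
  have hIcc : EqOn w (fun _ => c) (Icc a b) :=
    hIoo.of_subset_closure hw continuousOn_const Ioo_subset_Icc_self (by rw [closure_Ioo hab.ne])
  intro x hx
  rw [hIcc hx, hIcc (left_mem_Icc.2 hab.le)]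

/-- A continuous function with an `L²` weak derivative is a primitive of it. -/
theorem HasWeakDerivL2.sub_eq_integral [CompleteSpace E] {a b : ℝ} (hab : a < b) {u g : ℝ → E}
    (hu : ContinuousOn u (Icc a b)) (h : HasWeakDerivL2 a b u g) {x : ℝ} (hx : x ∈ Icc a b) :
    u x - u a = ∫ t in a..x, g t := by
  have hg := intervalIntegrable_of_memLp h.1 hab.le
  have hGc : ContinuousOn (fun x => ∫ t in a..x, g t) (Icc a b) := by
    have := (absolutelyContinuousOnInterval_integral hg).continuousOn
    rwa [uIcc_of_le hab.le] at this
  have := eq_left_of_integral_deriv_smul_eq_zero hab (hu.sub hGc) (fun φ hφ => by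
    have hdc : Continuous (deriv φ) := (contDiff_infty_iff_deriv.1 hφ.1).2.continuous
    have hibp := integral_smul_eq_smul_integral_sub (φ := φ) (φ' := deriv φ)
      (fun x => ((contDiff_infty_iff_deriv.1 hφ.1).1 x).hasDerivAt) hdc hg
    have hwd := h.2 φ hφ
    rw [hibp, hφ.eq_zero (x := b) (by simp), zero_smul, zero_sub, neg_neg] at hwd
    change ∫ x in a..b, deriv φ x • (u x - ∫ t in a..x, g t) = 0
    simp only [smul_sub]
    rw [intervalIntegral.integral_sub, hwd, sub_self]
    · refine ContinuousOn.intervalIntegrable ?_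
      rw [uIcc_of_le hab.le]
      exact hdc.continuousOn.smul hu
    · refine ContinuousOn.intervalIntegrable ?_
      rw [uIcc_of_le hab.le]
      exact hdc.continuousOn.smul hGc) x hx
  have h0 : u x - ∫ t in a..x, g t = u a - ∫ t in a..a, g t := this
  rw [intervalIntegral.integral_same, sub_zero] at h0
  rw [← h0, sub_sub_cancel]

theorem MemH1.hasWeakDerivL2_weakDeriv {a b : ℝ} {u : ℝ → E} (h : MemH1 a b u) :
    HasWeakDerivL2 a b u (weakDeriv a b u) := by
  unfold weakDeriv
  rw [dif_pos h.exists_weakDeriv]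
  exact h.exists_weakDeriv.choose_spec

theorem HasWeakDerivL2.ae_eq [CompleteSpace E] {a b : ℝ} (hab : a < b) {u g g' : ℝ → E}
    (h : HasWeakDerivL2 a b u g) (h' : HasWeakDerivL2 a b u g') :
    ∀ᵐ x, x ∈ Ioo a b → g x = g' x := by
  have hi := intervalIntegrable_of_memLp h.1 hab.le
  have hi' := intervalIntegrable_of_memLp h'.1 hab.le
  have := isOpen_Ioo.ae_eq_zero_of_integral_contDiff_smul_eq_zero (μ := volume)
    (f := fun x => g x - g' x) (U := Ioo a b) ?_ ?_
  · filter_upwards [this] with x hx hx'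
    exact sub_eq_zero.1 (hx hx')
  · rw [intervalIntegrable_iff_integrableOn_Ioo_of_le hab.le] at hi hi'
    exact (hi.sub hi').locallyIntegrableOn
  · intro φ h1 h2 h3
    have hφ : IsTestFunction a b φ := ⟨h1, h2, h3⟩
    rw [hφ.integral_smul_eq hab.le]
    simp only [smul_sub]
    rw [intervalIntegral.integral_sub (hi.continuousOn_smul h1.continuous.continuousOn)
      (hi'.continuousOn_smul h1.continuous.continuousOn)]
    have e1 := h.2 φ hφ
    have e2 := h'.2 φ hφ
    rw [e1] at e2
    rw [neg_inj.1 e2, sub_self]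

/-- A continuously differentiable function has its classical derivative as weak derivative. -/
theorem hasWeakDerivL2_of_hasDerivAt [CompleteSpace E] {a b : ℝ} {u u' : ℝ → E}
    (hu : ∀ x, HasDerivAt u (u' x) x) (hu' : Continuous u') : HasWeakDerivL2 a b u u' := by
  refine ⟨?_, fun φ hφ => ?_⟩
  · rw [memLp_two_iff_integrable_sq_norm hu'.aestronglyMeasurable]
    exact ((hu'.norm.pow 2).integrableOn_Icc (a := a) (b := b)).mono_set Ioo_subset_Icc_self
  · have hdc : Continuous (deriv φ) := (contDiff_infty_iff_deriv.1 hφ.1).2.continuous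
    have := intervalIntegral.integral_smul_deriv_eq_deriv_smul (a := a) (b := b)
      (fun x _ => ((contDiff_infty_iff_deriv.1 hφ.1).1 x).hasDerivAt) (fun x _ => hu x)
      (hdc.intervalIntegrable _ _) (hu'.intervalIntegrable _ _)
    rw [this, hφ.eq_zero (x := a) (by simp), hφ.eq_zero (x := b) (by simp)]
    simp

end SobolevTools

/-! ### Energy densities -/

section EnergyDensity

variable {E F G : Type*} [NormedAddCommGroup E] [NormedAddCommGroup F] [NormedAddCommGroup G]

/-- `Q` is an energy density of `u` on `[a, b]`: the squared increments of `u` are controlled by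
`Q` as those of an `H¹` function are controlled by the square of its derivative. This is all that
the error analysis needs from membership in `H¹`, and it is stable under Lipschitz operations
without any chain rule. -/
structure HasEnergyDensity (a b : ℝ) (u : ℝ → E) (Q : ℝ → ℝ) : Prop where
  intervalIntegrable : IntervalIntegrable Q volume a b
  nonneg : ∀ x, 0 ≤ Q x
  sq_norm_sub_le : ∀ x y, a ≤ x → x ≤ y → y ≤ b →
    ‖u y - u x‖ ^ 2 ≤ (y - x) * ∫ t in x..y, Q t

/-- The Cauchy–Schwarz inequality against the constant function `1`. -/
theorem sq_integral_le_mul_integral_sq {f : ℝ → ℝ} {x y : ℝ} (hxy : x ≤ y)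
    (hf : IntervalIntegrable f volume x y)
    (hf2 : IntervalIntegrable (fun t => f t ^ 2) volume x y) :
    (∫ t in x..y, f t) ^ 2 ≤ (y - x) * ∫ t in x..y, f t ^ 2 := by
  rcases hxy.eq_or_lt with rfl | hlt
  · simp
  have hpos : 0 < y - x := sub_pos.2 hlt
  set I := ∫ t in x..y, f t with hI
  -- integrate the square of the deviation of `f` from its mean `I / (y - x)`
  have h : 0 ≤ ∫ t in x..y, ((y - x) * f t ^ 2 - 2 * I * f t) + I ^ 2 / (y - x) := by
    refine intervalIntegral.integral_nonneg hxy fun t _ => ?_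
    have : (y - x) * f t ^ 2 - 2 * I * f t + I ^ 2 / (y - x)
        = ((y - x) * f t - I) ^ 2 / (y - x) := by
      field_simp
      ring
    rw [this]
    positivity
  rw [intervalIntegral.integral_add ((hf2.const_mul _).sub (hf.const_mul _)) (by simp),
    intervalIntegral.integral_sub (hf2.const_mul _) (hf.const_mul _),
    intervalIntegral.integral_const_mul, intervalIntegral.integral_const_mul,
    intervalIntegral.integral_const, ← hI, smul_eq_mul, mul_div_cancel₀ _ hpos.ne'] at h
  nlinarith

theorem hasEnergyDensity_of_sub_eq_integral [NormedSpace ℝ E] {a b : ℝ} {u g : ℝ → E}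
    (hab : a ≤ b) (hg : MemLp g 2 (volume.restrict (Ioo a b)))
    (h : ∀ x ∈ Icc a b, u x - u a = ∫ t in a..x, g t) :
    HasEnergyDensity a b u (fun x => ‖g x‖ ^ 2) := by
  have hgi := intervalIntegrable_of_memLp hg hab
  have hg2 : IntervalIntegrable (fun x => ‖g x‖ ^ 2) volume a b := by
    rw [intervalIntegrable_iff_integrableOn_Ioo_of_le hab]
    exact (memLp_two_iff_integrable_sq_norm hg.1).1 hg
  refine ⟨hg2, fun x => by positivity, fun x y hx hxy hy => ?_⟩
  have hsub : uIcc x y ⊆ uIcc a b := by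
    rw [uIcc_of_le hxy, uIcc_of_le hab]
    exact Icc_subset_Icc hx hy
  have hax : IntervalIntegrable g volume a x := hgi.mono_set (by
    rw [uIcc_of_le hx, uIcc_of_le hab]; exact Icc_subset_Icc_right (hxy.trans hy))
  have hay : IntervalIntegrable g volume a y := hgi.mono_set (by
    rw [uIcc_of_le (hx.trans hxy), uIcc_of_le hab]; exact Icc_subset_Icc_right hy)
  have he : u y - u x = ∫ t in x..y, g t := by
    rw [← intervalIntegral.integral_interval_sub_left hay hax,
      ← h x ⟨hx, hxy.trans hy⟩, ← h y ⟨hx.trans hxy, hy⟩, sub_sub_sub_cancel_right]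
  have h1 : ‖u y - u x‖ ≤ ∫ t in x..y, ‖g t‖ := by
    rw [he]; exact intervalIntegral.norm_integral_le_integral_norm hxy
  calc ‖u y - u x‖ ^ 2 ≤ (∫ t in x..y, ‖g t‖) ^ 2 := by gcongr
    _ ≤ _ := sq_integral_le_mul_integral_sq hxy (hgi.mono_set hsub).norm (hg2.mono_set hsub)

variable {a b : ℝ} {u : ℝ → E} {Q : ℝ → ℝ}

theorem HasEnergyDensity.intervalIntegrable_of_le (h : HasEnergyDensity a b u Q) {x y : ℝ}
    (hx : a ≤ x) (hxy : x ≤ y) (hy : y ≤ b) : IntervalIntegrable Q volume x y :=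
  h.intervalIntegrable.mono_set (by
    rw [uIcc_of_le hxy, uIcc_of_le (hx.trans (hxy.trans hy))]
    exact Icc_subset_Icc hx hy)

theorem HasEnergyDensity.integral_nonneg (h : HasEnergyDensity a b u Q) {x y : ℝ}
    (hxy : x ≤ y) : 0 ≤ ∫ t in x..y, Q t :=
  intervalIntegral.integral_nonneg hxy fun t _ => h.nonneg t

theorem HasEnergyDensity.integral_mono (h : HasEnergyDensity a b u Q) {x y z w : ℝ}
    (hx : a ≤ z) (hzx : z ≤ x) (hxy : x ≤ y) (hyw : y ≤ w) (hw : w ≤ b) :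
    ∫ t in x..y, Q t ≤ ∫ t in z..w, Q t :=
  intervalIntegral.integral_mono_interval hzx hxy hyw (ae_of_all _ fun t => h.nonneg t)
    (h.intervalIntegrable_of_le hx (hzx.trans (hxy.trans hyw)) hw)

/-- A function whose increments are controlled by those of `u` and `v` inherits an energy
density. -/
theorem HasEnergyDensity.of_norm_sub_le {v : ℝ → F} {w : ℝ → G} {R : ℝ → ℝ}
    (hu : HasEnergyDensity a b u Q) (hv : HasEnergyDensity a b v R) (A B : ℝ)
    (h : ∀ x ∈ Icc a b, ∀ y ∈ Icc a b, ‖w y - w x‖ ≤ A * ‖u y - u x‖ + B * ‖v y - v x‖) :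
    HasEnergyDensity a b w (fun x => 2 * A ^ 2 * Q x + 2 * B ^ 2 * R x) := by
  refine ⟨(hu.intervalIntegrable.const_mul _).add (hv.intervalIntegrable.const_mul _),
    fun x => ?_, fun x y hx hxy hy => ?_⟩
  · have := hu.nonneg x
    have := hv.nonneg x
    positivity
  · have h0 := h x ⟨hx, hxy.trans hy⟩ y ⟨hx.trans hxy, hy⟩
    have h1 := hu.sq_norm_sub_le x y hx hxy hy
    have h2 := hv.sq_norm_sub_le x y hx hxy hy
    rw [intervalIntegral.integral_add ((hu.intervalIntegrable_of_le hx hxy hy).const_mul _)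
      ((hv.intervalIntegrable_of_le hx hxy hy).const_mul _),
      intervalIntegral.integral_const_mul, intervalIntegral.integral_const_mul]
    calc ‖w y - w x‖ ^ 2 ≤ (A * ‖u y - u x‖ + B * ‖v y - v x‖) ^ 2 := by gcongr
      _ ≤ 2 * A ^ 2 * ‖u y - u x‖ ^ 2 + 2 * B ^ 2 * ‖v y - v x‖ ^ 2 := by
        nlinarith [sq_nonneg (A * ‖u y - u x‖ - B * ‖v y - v x‖)]
      _ ≤ 2 * A ^ 2 * ((y - x) * ∫ t in x..y, Q t) + 2 * B ^ 2 * ((y - x) * ∫ t in x..y, R t) := by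
        gcongr
      _ = _ := by ring

theorem HasEnergyDensity.integral_weighted_add {v : ℝ → F} {R : ℝ → ℝ}
    (hu : HasEnergyDensity a b u Q) (hv : HasEnergyDensity a b v R) (A B : ℝ) :
    ∫ x in a..b, (2 * A ^ 2 * Q x + 2 * B ^ 2 * R x)
      = 2 * A ^ 2 * (∫ x in a..b, Q x) + 2 * B ^ 2 * ∫ x in a..b, R x := by
  rw [intervalIntegral.integral_add (hu.intervalIntegrable.const_mul _)
      (hv.intervalIntegrable.const_mul _),
      intervalIntegral.integral_const_mul, intervalIntegral.integral_const_mul]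

theorem HasEnergyDensity.sq_norm_sub_le_total (h : HasEnergyDensity a b u Q) {x y : ℝ}
    (hx : x ∈ Icc a b) (hy : y ∈ Icc a b) :
    ‖u y - u x‖ ^ 2 ≤ (b - a) * ∫ t in a..b, Q t := by
  wlog hxy : x ≤ y generalizing x y
  · rw [norm_sub_rev]
    exact this hy hx (le_of_not_ge hxy)
  refine (h.sq_norm_sub_le x y hx.1 hxy hy.2).trans ?_
  have h1 := h.integral_mono le_rfl hx.1 hxy hy.2 le_rfl
  have h2 := h.integral_nonneg hxy
  have : y - x ≤ b - a := by linarith [hx.1, hy.2]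
  exact mul_le_mul this h1 h2 (by linarith [hx.1.trans hx.2])

/-- The embedding `H¹ ⊆ L∞`. -/
theorem HasEnergyDensity.sq_norm_le (hab : a < b) (hu : ContinuousOn u (Icc a b))
    (h : HasEnergyDensity a b u Q) {x : ℝ} (hx : x ∈ Icc a b) :
    ‖u x‖ ^ 2 ≤ 2 / (b - a) * (∫ y in a..b, ‖u y‖ ^ 2) + 2 * (b - a) * ∫ t in a..b, Q t := by
  have hpos : 0 < b - a := sub_pos.2 hab
  have hi : IntervalIntegrable (fun y => ‖u y‖ ^ 2) volume a b := by
    apply ContinuousOn.intervalIntegrable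
    rw [uIcc_of_le hab.le]
    exact hu.norm.pow 2
  -- average the pointwise bound over `y`
  have h1 : ∫ y in a..b, ‖u x‖ ^ 2
      ≤ ∫ y in a..b, (2 * ‖u y‖ ^ 2 + 2 * ((b - a) * ∫ t in a..b, Q t)) := by
    refine intervalIntegral.integral_mono_on hab.le (by simp)
      ((hi.const_mul _).add (by simp)) fun y hy => ?_
    have h2 := h.sq_norm_sub_le_total hy hx
    have h3 : ‖u x‖ ≤ ‖u y‖ + ‖u x - u y‖ := by
      have := norm_add_le (u y) (u x - u y)
      rwa [add_sub_cancel] at this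
    have h4 : ‖u x‖ ^ 2 ≤ (‖u y‖ + ‖u x - u y‖) ^ 2 := by gcongr
    nlinarith [sq_nonneg (‖u y‖ - ‖u x - u y‖)]
  rw [intervalIntegral.integral_add (hi.const_mul _) (by simp),
    intervalIntegral.integral_const_mul, intervalIntegral.integral_const,
    intervalIntegral.integral_const, smul_eq_mul, smul_eq_mul] at h1
  have h5 : ‖u x‖ ^ 2 = ((b - a) * ‖u x‖ ^ 2) / (b - a) := by field_simp
  rw [h5, div_le_iff₀ hpos]
  refine h1.trans (le_of_eq ?_)
  field_simp

theorem gridPoint_zero (a b : ℝ) (N : ℕ) : gridPoint a b N 0 = a := by simp [gridPoint]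

theorem gridPoint_self (a b : ℝ) {N : ℕ} (hN : 1 ≤ N) : gridPoint a b N N = b := by
  have : (N : ℝ) ≠ 0 := by positivity
  rw [gridPoint, meshSize]
  field_simp
  ring

theorem gridPoint_succ_sub (a b : ℝ) (N j : ℕ) :
    gridPoint a b N (j + 1) - gridPoint a b N j = meshSize a b N := by
  rw [gridPoint, gridPoint]
  push_cast
  ring

theorem meshSize_nonneg (hab : a ≤ b) (N : ℕ) : 0 ≤ meshSize a b N := by
  rw [meshSize]
  have := sub_nonneg.2 hab
  positivity

theorem gridPoint_mono (hab : a ≤ b) (N : ℕ) : Monotone (gridPoint a b N) := by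
  refine monotone_nat_of_le_succ fun j => ?_
  linarith [gridPoint_succ_sub a b N j, meshSize_nonneg hab N]

theorem gridPoint_mem_Icc (hab : a ≤ b) {N j : ℕ} (hN : 1 ≤ N) (hj : j ≤ N) :
    gridPoint a b N j ∈ Icc a b := by
  constructor
  · conv_lhs => rw [← gridPoint_zero a b N]
    exact gridPoint_mono hab N (Nat.zero_le j)
  · conv_rhs => rw [← gridPoint_self a b hN]
    exact gridPoint_mono hab N hj

theorem sum_integral_gridPoint (hab : a ≤ b) {N : ℕ} (hN : 1 ≤ N) {f : ℝ → ℝ}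
    (hf : IntervalIntegrable f volume a b) :
    ∑ j ∈ Finset.range N, ∫ x in gridPoint a b N j..gridPoint a b N (j + 1), f x
      = ∫ x in a..b, f x := by
  rw [intervalIntegral.sum_integral_adjacent_intervals, gridPoint_zero, gridPoint_self a b hN]
  intro j hj
  refine hf.mono_set ?_
  rw [uIcc_of_le (gridPoint_mono hab N (Nat.le_succ j)), uIcc_of_le hab]
  exact Icc_subset_Icc (gridPoint_mem_Icc hab hN hj.le).1 (gridPoint_mem_Icc hab hN hj).2

theorem HasEnergyDensity.sum_sq_norm_gridPoint_sub_le (h : HasEnergyDensity a b u Q) (hab : a ≤ b)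
    {N : ℕ} (hN : 1 ≤ N) :
    ∑ j ∈ Finset.range N, ‖u (gridPoint a b N (j + 1)) - u (gridPoint a b N j)‖ ^ 2
      ≤ meshSize a b N * ∫ x in a..b, Q x := by
  rw [← sum_integral_gridPoint hab hN h.intervalIntegrable, Finset.mul_sum]
  refine Finset.sum_le_sum fun j hj => ?_
  rw [Finset.mem_range] at hj
  have := h.sq_norm_sub_le _ _ (gridPoint_mem_Icc hab hN hj.le).1
    (gridPoint_mono hab N (Nat.le_succ j)) (gridPoint_mem_Icc hab hN hj).2
  rwa [gridPoint_succ_sub] at this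

/-- The Poincaré inequality for functions vanishing at the grid points. -/
theorem HasEnergyDensity.integral_sq_norm_le (h : HasEnergyDensity a b u Q) (hab : a ≤ b)
    {N : ℕ} (hN : 1 ≤ N) (hu : ContinuousOn u (Icc a b))
    (h0 : ∀ j < N, u (gridPoint a b N j) = 0) :
    ∫ x in a..b, ‖u x‖ ^ 2 ≤ meshSize a b N ^ 2 * ∫ x in a..b, Q x := by
  have hi : IntervalIntegrable (fun y => ‖u y‖ ^ 2) volume a b := by
    apply ContinuousOn.intervalIntegrable
    rw [uIcc_of_le hab]
    exact hu.norm.pow 2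
  rw [← sum_integral_gridPoint hab hN h.intervalIntegrable, ← sum_integral_gridPoint hab hN hi,
    Finset.mul_sum]
  refine Finset.sum_le_sum fun j hj => ?_
  rw [Finset.mem_range] at hj
  have hl := (gridPoint_mem_Icc hab hN hj.le).1
  have hr := (gridPoint_mem_Icc hab hN hj).2
  have hm := gridPoint_mono hab N (Nat.le_succ j)
  have hd := gridPoint_succ_sub a b N j
  set p := gridPoint a b N j
  set q := gridPoint a b N (j + 1)
  have hint : IntervalIntegrable (fun y => ‖u y‖ ^ 2) volume p q := hi.mono_set (by
    rw [uIcc_of_le hm, uIcc_of_le hab]; exact Icc_subset_Icc hl hr)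
  calc ∫ x in p..q, ‖u x‖ ^ 2 ≤ ∫ x in p..q, meshSize a b N * ∫ t in p..q, Q t := by
        refine intervalIntegral.integral_mono_on hm hint (by simp) fun x hx => ?_
        have h1 := h.sq_norm_sub_le p x hl hx.1 (hx.2.trans hr)
        rw [h0 j hj, sub_zero] at h1
        refine h1.trans (mul_le_mul (by linarith [hx.2])
          (h.integral_mono hl le_rfl hx.1 hx.2 hr) (h.integral_nonneg hx.1) (by linarith))
    _ = meshSize a b N ^ 2 * ∫ t in p..q, Q t := by
        rw [intervalIntegral.integral_const, smul_eq_mul, hd]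
        ring

end EnergyDensity

/-! ### Energy densities of `H¹` functions -/

section H1

variable {E : Type*} [NormedAddCommGroup E] [NormedSpace ℝ E] {a b M : ℝ} {u : ℝ → E}

theorem l2Norm_sq {F : Type*} [NormedAddCommGroup F] (hab : a ≤ b) (u : ℝ → F) :
    l2Norm a b u ^ 2 = ∫ x in a..b, ‖u x‖ ^ 2 := by
  rw [l2Norm, Real.sq_sqrt]
  exact intervalIntegral.integral_nonneg hab fun x _ => by positivity

theorem h1Norm_sq (hab : a ≤ b) (u : ℝ → E) : h1Norm a b u ^ 2
    = (∫ x in a..b, ‖u x‖ ^ 2) + ∫ x in a..b, ‖weakDeriv a b u x‖ ^ 2 := by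
  rw [h1Norm, Real.sq_sqrt (by positivity), l2Norm_sq hab, l2Norm_sq hab]

theorem integral_sq_norm_le_of_h1Norm_le (hab : a ≤ b) (hM : h1Norm a b u ≤ M) :
    ∫ x in a..b, ‖u x‖ ^ 2 ≤ M ^ 2 := by
  have h1 : h1Norm a b u ^ 2 ≤ M ^ 2 := by
    have : 0 ≤ h1Norm a b u := Real.sqrt_nonneg _
    gcongr
  have h2 : 0 ≤ ∫ x in a..b, ‖weakDeriv a b u x‖ ^ 2 :=
    intervalIntegral.integral_nonneg hab fun x _ => by positivity
  rw [h1Norm_sq hab] at h1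
  linarith

theorem MemH1.exists_hasEnergyDensity [CompleteSpace E] (hab : a < b) (h : MemH1 a b u)
    (hM : h1Norm a b u ≤ M) :
    ∃ Q, HasEnergyDensity a b u Q ∧ ∫ x in a..b, Q x ≤ M ^ 2 := by
  have hd := h.hasWeakDerivL2_weakDeriv
  refine ⟨_, hasEnergyDensity_of_sub_eq_integral hab.le hd.1 fun x hx =>
    hd.sub_eq_integral hab h.continuousOn hx, ?_⟩
  have h1 : h1Norm a b u ^ 2 ≤ M ^ 2 := by
    have : 0 ≤ h1Norm a b u := Real.sqrt_nonneg _
    gcongr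
  have h2 : 0 ≤ ∫ x in a..b, ‖u x‖ ^ 2 :=
    intervalIntegral.integral_nonneg hab.le fun x _ => by positivity
  rw [h1Norm_sq hab.le] at h1
  linarith

end H1

/-! ### Discrete and continuous orthogonality of sines and cosines -/

section Trigonometry

theorem two_sin_half_mul_sum_cos_half (θ : ℝ) (N : ℕ) :
    2 * Real.sin (θ / 2) * ∑ j ∈ Finset.range N, Real.cos ((j + 1 / 2) * θ)
      = Real.sin (N * θ) := by
  induction N with
  | zero => simp
  | succ n ih =>
    rw [Finset.sum_range_succ, mul_add, ih]
    push_cast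
    have h1 : ((n : ℝ) + 1) * θ = (n + 1 / 2) * θ + θ / 2 := by ring
    have h2 : (n : ℝ) * θ = (n + 1 / 2) * θ - θ / 2 := by ring
    rw [h1, h2, Real.sin_add, Real.sin_sub]
    ring

theorem two_sin_half_mul_sum_cos (θ : ℝ) (N : ℕ) :
    2 * Real.sin (θ / 2) * ∑ j ∈ Finset.range N, Real.cos (j * θ)
      = Real.sin (N * θ - θ / 2) + Real.sin (θ / 2) := by
  induction N with
  | zero => simp
  | succ n ih =>
    rw [Finset.sum_range_succ, mul_add, ih]
    push_cast
    have h1 : ((n : ℝ) + 1) * θ - θ / 2 = n * θ + θ / 2 := by ring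
    rw [h1, Real.sin_add, Real.sin_sub]
    ring

theorem sin_half_ne_zero {k : ℤ} {N : ℕ} (hk : k ≠ 0) (hkN : |k| < 2 * N) :
    Real.sin (k * Real.pi / N / 2) ≠ 0 := by
  have hN : 0 < (N : ℝ) := by
    have : 0 < N := by
      have := abs_nonneg k
      omega
    exact_mod_cast this
  have hkR : |(k : ℝ)| < 2 * N := by exact_mod_cast hkN
  rw [abs_lt] at hkR
  have hpi := Real.pi_pos
  have hx1 : -Real.pi < k * Real.pi / N / 2 := by
    rw [div_div, lt_div_iff₀ (by positivity)]
    nlinarith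
  have hx2 : k * Real.pi / N / 2 < Real.pi := by
    rw [div_div, div_lt_iff₀ (by positivity)]
    nlinarith
  rw [Ne, Real.sin_eq_zero_iff_of_lt_of_lt hx1 hx2]
  have : (k : ℝ) ≠ 0 := by exact_mod_cast hk
  positivity

theorem sum_cos_half_eq_zero {k : ℤ} {N : ℕ} (hk : k ≠ 0) (hkN : |k| < 2 * N) :
    ∑ j ∈ Finset.range N, Real.cos ((j + 1 / 2) * (k * Real.pi / N)) = 0 := by
  have hN : (N : ℝ) ≠ 0 := by
    have : N ≠ 0 := by
      have := abs_nonneg k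
      omega
    exact_mod_cast this
  have h := two_sin_half_mul_sum_cos_half (k * Real.pi / N) N
  rw [mul_div_cancel₀ _ hN, Real.sin_int_mul_pi] at h
  simpa [sin_half_ne_zero hk hkN] using h

theorem sum_cos_eq {k : ℤ} {N : ℕ} (hk : k ≠ 0) (hkN : |k| < 2 * N) :
    ∑ j ∈ Finset.range N, Real.cos (j * (k * Real.pi / N))
      = (1 - Real.cos (k * Real.pi)) / 2 := by
  have hN : (N : ℝ) ≠ 0 := by
    have : N ≠ 0 := by
      have := abs_nonneg k
      omega
    exact_mod_cast this
  have h := two_sin_half_mul_sum_cos (k * Real.pi / N) N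
  rw [mul_div_cancel₀ _ hN, Real.sin_sub, Real.sin_int_mul_pi] at h
  have h0 := sin_half_ne_zero hk hkN
  have : 2 * Real.sin (k * Real.pi / N / 2) *
      (∑ j ∈ Finset.range N, Real.cos (j * (k * Real.pi / N))
        - (1 - Real.cos (k * Real.pi)) / 2) = 0 := by
    rw [mul_sub, h]
    ring
  simpa [h0, sub_eq_zero] using this

/-- Orthogonality of the sines on the grid. -/
theorem sum_sin_mul_sin {N l m : ℕ} (hl : l ∈ Finset.Ico 1 N) (hm : m ∈ Finset.Ico 1 N) :
    ∑ j ∈ Finset.Ico 1 N, Real.sin (j * Real.pi * l / N) * Real.sin (j * Real.pi * m / N)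
      = if l = m then (N : ℝ) / 2 else 0 := by
  rw [Finset.mem_Ico] at hl hm
  have h0 : ∑ j ∈ Finset.Ico 1 N, Real.sin (j * Real.pi * l / N) * Real.sin (j * Real.pi * m / N)
      = ∑ j ∈ Finset.range N, Real.sin (j * Real.pi * l / N) * Real.sin (j * Real.pi * m / N) := by
    conv_rhs => rw [Finset.range_eq_Ico, Finset.sum_eq_sum_Ico_succ_bot (by omega)]
    simp
  have h1 : ∀ j ∈ Finset.range N,
      Real.sin (j * Real.pi * l / N) * Real.sin (j * Real.pi * m / N)
      = (Real.cos (j * (((l - m : ℤ) : ℝ) * Real.pi / N))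
        - Real.cos (j * (((l + m : ℤ) : ℝ) * Real.pi / N))) / 2 := fun j _ => by
    push_cast
    rw [show (j : ℝ) * ((l - m) * Real.pi / N) = j * Real.pi * l / N - j * Real.pi * m / N by ring,
      show (j : ℝ) * ((l + m) * Real.pi / N) = j * Real.pi * l / N + j * Real.pi * m / N by ring,
      Real.cos_sub, Real.cos_add]
    ring
  rw [h0, Finset.sum_congr rfl h1, ← Finset.sum_div, Finset.sum_sub_distrib,
    sum_cos_eq (k := l + m) (by omega) (by rw [abs_of_pos (by omega)]; omega)]
  split_ifs with hlm
  · subst hlm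
    have : Real.cos (((l + l : ℤ) : ℝ) * Real.pi) = 1 := by
      rw [← two_mul]
      push_cast
      rw [show 2 * (l : ℝ) * Real.pi = l * (2 * Real.pi) by ring]
      exact Real.cos_nat_mul_two_pi l
    rw [this]
    simp
  · rw [sum_cos_eq (k := l - m) (by omega) (by rw [abs_lt]; omega)]
    push_cast
    rw [sub_mul, add_mul, Real.cos_sub, Real.cos_add, Real.sin_nat_mul_pi]
    ring

/-- Orthogonality of the cosines on the grid of the midpoints. -/
theorem sum_cos_mul_cos {N l m : ℕ} (hl : l ∈ Finset.Ico 1 N) (hm : m ∈ Finset.Ico 1 N) :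
    ∑ j ∈ Finset.range N,
      Real.cos ((j + 1 / 2) * (Real.pi * l / N)) * Real.cos ((j + 1 / 2) * (Real.pi * m / N))
      = if l = m then (N : ℝ) / 2 else 0 := by
  rw [Finset.mem_Ico] at hl hm
  have h1 : ∀ j ∈ Finset.range N,
      Real.cos ((j + 1 / 2) * (Real.pi * l / N)) * Real.cos ((j + 1 / 2) * (Real.pi * m / N))
      = (Real.cos ((j + 1 / 2) * (((l - m : ℤ) : ℝ) * Real.pi / N))
        + Real.cos ((j + 1 / 2) * (((l + m : ℤ) : ℝ) * Real.pi / N))) / 2 := fun j _ => by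
    push_cast
    rw [show ((j : ℝ) + 1 / 2) * ((l - m) * Real.pi / N)
        = (j + 1 / 2) * (Real.pi * l / N) - (j + 1 / 2) * (Real.pi * m / N) by ring,
      show ((j : ℝ) + 1 / 2) * ((l + m) * Real.pi / N)
        = (j + 1 / 2) * (Real.pi * l / N) + (j + 1 / 2) * (Real.pi * m / N) by ring,
      Real.cos_sub, Real.cos_add]
    ring
  rw [Finset.sum_congr rfl h1, ← Finset.sum_div, Finset.sum_add_distrib,
    sum_cos_half_eq_zero (k := l + m) (by omega) (by rw [abs_of_pos (by omega)]; omega)]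
  split_ifs with hlm
  · subst hlm
    simp
  · rw [sum_cos_half_eq_zero (k := l - m) (by omega) (by rw [abs_lt]; omega)]
    simp

theorem integral_cos_int_mul {a b : ℝ} (hab : a < b) {k : ℤ} (hk : k ≠ 0) :
    ∫ x in a..b, Real.cos (k * Real.pi / (b - a) * (x - a)) = 0 := by
  have hpos : 0 < b - a := sub_pos.2 hab
  have hkR : (k : ℝ) ≠ 0 := by exact_mod_cast hk
  set c := k * Real.pi / (b - a) with hc
  have hc0 : c ≠ 0 := by
    have := Real.pi_ne_zero
    positivity
  have hd : ∀ x ∈ uIcc a b, HasDerivAt (fun x => Real.sin (c * (x - a)) / c)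
      (Real.cos (c * (x - a))) x := fun x _ => by
    have h1 : HasDerivAt (fun x => c * (x - a)) c x := by
      simpa using ((hasDerivAt_id x).sub_const a).const_mul c
    have h2 := h1.sin.div_const c
    rwa [mul_div_cancel_right₀ _ hc0] at h2
  rw [intervalIntegral.integral_eq_sub_of_hasDerivAt hd
    (Continuous.intervalIntegrable (by fun_prop) _ _)]
  have : c * (b - a) = k * Real.pi := by
    rw [hc]; field_simp
  simp [this, Real.sin_int_mul_pi]

theorem continuous_cos_mul_sub (c a : ℝ) : Continuous fun x => Real.cos (c * (x - a)) := by
  fun_prop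

theorem integral_sin_mul_sin {a b : ℝ} (hab : a < b) {l m : ℕ} (hl : 1 ≤ l) (hm : 1 ≤ m) :
    ∫ x in a..b, Real.sin (freq a b l * (x - a)) * Real.sin (freq a b m * (x - a))
      = if l = m then (b - a) / 2 else 0 := by
  have h1 : ∀ x, Real.sin (freq a b l * (x - a)) * Real.sin (freq a b m * (x - a))
      = (Real.cos (((l - m : ℤ) : ℝ) * Real.pi / (b - a) * (x - a))
        - Real.cos (((l + m : ℤ) : ℝ) * Real.pi / (b - a) * (x - a))) / 2 := fun x => by
    push_cast
    rw [show ((l - m) * Real.pi / (b - a) * (x - a))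
        = freq a b l * (x - a) - freq a b m * (x - a) by rw [freq, freq]; ring,
      show ((l + m) * Real.pi / (b - a) * (x - a))
        = freq a b l * (x - a) + freq a b m * (x - a) by rw [freq, freq]; ring,
      Real.cos_sub, Real.cos_add]
    ring
  simp only [h1]
  rw [intervalIntegral.integral_div, intervalIntegral.integral_sub
    ((continuous_cos_mul_sub _ _).intervalIntegrable _ _)
    ((continuous_cos_mul_sub _ _).intervalIntegrable _ _),
    integral_cos_int_mul hab (k := l + m) (by omega)]
  split_ifs with hlm
  · subst hlm
    simp
  · rw [integral_cos_int_mul hab (k := l - m) (by omega)]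
    simp

theorem integral_cos_mul_cos {a b : ℝ} (hab : a < b) {l m : ℕ} (hl : 1 ≤ l) (hm : 1 ≤ m) :
    ∫ x in a..b, Real.cos (freq a b l * (x - a)) * Real.cos (freq a b m * (x - a))
      = if l = m then (b - a) / 2 else 0 := by
  have h1 : ∀ x, Real.cos (freq a b l * (x - a)) * Real.cos (freq a b m * (x - a))
      = (Real.cos (((l - m : ℤ) : ℝ) * Real.pi / (b - a) * (x - a))
        + Real.cos (((l + m : ℤ) : ℝ) * Real.pi / (b - a) * (x - a))) / 2 := fun x => by
    push_cast
    rw [show ((l - m) * Real.pi / (b - a) * (x - a))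
        = freq a b l * (x - a) - freq a b m * (x - a) by rw [freq, freq]; ring,
      show ((l + m) * Real.pi / (b - a) * (x - a))
        = freq a b l * (x - a) + freq a b m * (x - a) by rw [freq, freq]; ring,
      Real.cos_sub, Real.cos_add]
    ring
  simp only [h1]
  rw [intervalIntegral.integral_div, intervalIntegral.integral_add
    ((continuous_cos_mul_sub _ _).intervalIntegrable _ _)
    ((continuous_cos_mul_sub _ _).intervalIntegrable _ _),
    integral_cos_int_mul hab (k := l + m) (by omega)]
  split_ifs with hlm
  · subst hlm
    simp
  · rw [integral_cos_int_mul hab (k := l - m) (by omega)]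
    simp

end Trigonometry

/-! ### Parseval identities -/

section Parseval

variable {ι κ : Type*} [Fintype ι] [DecidableEq ι]

omit [DecidableEq ι] in
theorem sq_norm_sum_mul_ofReal (d : ι → ℂ) (s : ι → ℝ) :
    ‖∑ l, d l * (s l : ℂ)‖ ^ 2
      = ∑ l, ∑ m, (d l * (starRingEnd ℂ) (d m)).re * (s l * s m) := by
  have h : ((‖∑ l, d l * (s l : ℂ)‖ ^ 2 : ℝ) : ℂ)
      = ∑ l, ∑ m, d l * (starRingEnd ℂ) (d m) * ((s l * s m : ℝ) : ℂ) := by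
    push_cast
    rw [← Complex.mul_conj', map_sum, Finset.sum_mul_sum]
    refine Finset.sum_congr rfl fun l _ => Finset.sum_congr rfl fun m _ => ?_
    rw [map_mul, Complex.conj_ofReal]
    ring
  have h2 := congrArg Complex.re h
  rw [Complex.ofReal_re] at h2
  rw [h2, Complex.re_sum]
  refine Finset.sum_congr rfl fun l _ => ?_
  rw [Complex.re_sum]
  exact Finset.sum_congr rfl fun m _ => Complex.re_mul_ofReal _ _

theorem sum_sum_re_mul_ite (d : ι → ℂ) (c : ι → ℝ) :
    ∑ l, ∑ m, (d l * (starRingEnd ℂ) (d m)).re * (if l = m then c l else 0)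
      = ∑ l, c l * ‖d l‖ ^ 2 := by
  refine Finset.sum_congr rfl fun l _ => ?_
  rw [Finset.sum_eq_single l (fun m _ hm => by rw [if_neg hm.symm, mul_zero]) (by simp),
    if_pos rfl, Complex.mul_conj']
  norm_cast
  rw [mul_comm]

/-- Parseval's identity for a system that is orthogonal with respect to a finite sum. -/
theorem sum_sq_norm_sum_mul (t : Finset κ) (s : κ → ι → ℝ) (c : ι → ℝ)
    (h : ∀ l m, ∑ j ∈ t, s j l * s j m = if l = m then c l else 0) (d : ι → ℂ) :
    ∑ j ∈ t, ‖∑ l, d l * (s j l : ℂ)‖ ^ 2 = ∑ l, c l * ‖d l‖ ^ 2 := by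
  simp only [sq_norm_sum_mul_ofReal]
  rw [Finset.sum_comm, ← sum_sum_re_mul_ite]
  refine Finset.sum_congr rfl fun l _ => ?_
  rw [Finset.sum_comm]
  refine Finset.sum_congr rfl fun m _ => ?_
  rw [← Finset.mul_sum, h]

/-- Parseval's identity for a system that is orthogonal with respect to an integral. -/
theorem integral_sq_norm_sum_mul {a b : ℝ} (s : ι → ℝ → ℝ) (hs : ∀ l, Continuous (s l))
    (c : ι → ℝ) (h : ∀ l m, ∫ x in a..b, s l x * s m x = if l = m then c l else 0) (d : ι → ℂ) :
    ∫ x in a..b, ‖∑ l, d l * (s l x : ℂ)‖ ^ 2 = ∑ l, c l * ‖d l‖ ^ 2 := by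
  simp only [sq_norm_sum_mul_ofReal]
  have hi : ∀ l m, IntervalIntegrable
      (fun x => (d l * (starRingEnd ℂ) (d m)).re * (s l x * s m x)) volume a b := fun l m =>
    (((hs l).mul (hs m)).intervalIntegrable _ _).const_mul _
  have hi' : ∀ l, IntervalIntegrable
      (fun x => ∑ m, (d l * (starRingEnd ℂ) (d m)).re * (s l x * s m x)) volume a b := fun l =>
    (continuous_finsetSum _ fun m _ =>
      continuous_const.mul ((hs l).mul (hs m))).intervalIntegrable _ _
  rw [intervalIntegral.integral_finsetSum fun l _ => hi' l, ← sum_sum_re_mul_ite]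
  refine Finset.sum_congr rfl fun l _ => ?_
  rw [intervalIntegral.integral_finsetSum fun m _ => hi l m]
  refine Finset.sum_congr rfl fun m _ => ?_
  rw [intervalIntegral.integral_const_mul, h]

end Parseval

/-! ### Sine polynomials and the discrete sine transform -/

section SineSpace

/-- The space of the sine coefficients `(d_1, …, d_{N-1})`, with the Euclidean norm. -/
abbrev SineCoeffs (N : ℕ) : Type := EuclideanSpace ℂ (Finset.Ico 1 N)

/-- The sine polynomial `∑ d_l sin(μ_l (x - a))`. -/
def sineSynth (a b : ℝ) {N : ℕ} (d : SineCoeffs N) (x : ℝ) : ℂ :=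
  ∑ l : Finset.Ico 1 N, d l * (Real.sin (freq a b l * (x - a)) : ℂ)

/-- The derivative of the sine polynomial `∑ d_l sin(μ_l (x - a))`. -/
def sineSynthDeriv (a b : ℝ) {N : ℕ} (d : SineCoeffs N) (x : ℝ) : ℂ :=
  ∑ l : Finset.Ico 1 N, d l * ((freq a b l * Real.cos (freq a b l * (x - a)) : ℝ) : ℂ)

/-- The discrete sine coefficients of a grid function. -/
def sineVec (N : ℕ) (w : ℕ → ℂ) : SineCoeffs N :=
  WithLp.toLp 2 fun l => sineCoeff N w l

/-- The sine coefficients `2 / (b - a) ∫ u(x) sin(μ_l (x - a)) dx`, `1 ≤ l < N`, of a function. -/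
def fourierVec (a b : ℝ) (N : ℕ) (u : ℝ → ℂ) : SineCoeffs N :=
  WithLp.toLp 2 fun l =>
    ((2 / (b - a) : ℝ) : ℂ) * ∫ x in a..b, u x * (Real.sin (freq a b l * (x - a)) : ℂ)

/-- The squared `H¹` seminorm of a sine polynomial, up to the factor `(b - a) / 2`. -/
def sineEnergy (a b : ℝ) {N : ℕ} (d : SineCoeffs N) : ℝ :=
  ∑ l : Finset.Ico 1 N, freq a b l ^ 2 * ‖d l‖ ^ 2

variable {a b : ℝ} {N : ℕ}

theorem sineInterp_eq (w : ℕ → ℂ) (x : ℝ) :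
    sineInterp a b N w x = sineSynth a b (sineVec N w) x := by
  rw [sineInterp, sineSynth, ← Finset.sum_coe_sort]
  rfl

theorem continuous_sineSynth (d : SineCoeffs N) : Continuous (sineSynth a b d) := by
  unfold sineSynth
  fun_prop

theorem continuous_sineSynthDeriv (d : SineCoeffs N) : Continuous (sineSynthDeriv a b d) := by
  unfold sineSynthDeriv
  fun_prop

theorem hasDerivAt_sin_freq (l : ℕ) (x : ℝ) :
    HasDerivAt (fun x => Real.sin (freq a b l * (x - a)))
      (freq a b l * Real.cos (freq a b l * (x - a))) x := by
  have h1 : HasDerivAt (fun x => freq a b l * (x - a)) (freq a b l) x := by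
    simpa using ((hasDerivAt_id x).sub_const a).const_mul (freq a b l)
  simpa [mul_comm] using h1.sin

theorem hasDerivAt_sineSynth (d : SineCoeffs N) (x : ℝ) :
    HasDerivAt (sineSynth a b d) (sineSynthDeriv a b d x) x := by
  unfold sineSynth sineSynthDeriv
  refine HasDerivAt.fun_sum fun l _ => ?_
  exact (hasDerivAt_sin_freq (l : ℕ) x).ofReal_comp.const_mul (d l)

theorem sineSynth_left (d : SineCoeffs N) : sineSynth a b d a = 0 := by simp [sineSynth]

theorem integral_sq_norm_sineSynth (hab : a < b) (d : SineCoeffs N) :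
    ∫ x in a..b, ‖sineSynth a b d x‖ ^ 2 = (b - a) / 2 * ‖d‖ ^ 2 := by
  unfold sineSynth
  rw [integral_sq_norm_sum_mul (fun (l : Finset.Ico 1 N) x => Real.sin (freq a b l * (x - a)))
    (fun l => by fun_prop) (fun _ => (b - a) / 2) (fun l m => ?_), EuclideanSpace.norm_sq_eq,
    Finset.mul_sum]
  rw [integral_sin_mul_sin hab (Finset.mem_Ico.1 l.2).1 (Finset.mem_Ico.1 m.2).1]
  simp only [Subtype.ext_iff]

theorem integral_sq_norm_sineSynthDeriv (hab : a < b) (d : SineCoeffs N) :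
    ∫ x in a..b, ‖sineSynthDeriv a b d x‖ ^ 2 = (b - a) / 2 * sineEnergy a b d := by
  unfold sineSynthDeriv
  rw [integral_sq_norm_sum_mul
    (fun (l : Finset.Ico 1 N) x => freq a b l * Real.cos (freq a b l * (x - a)))
    (fun l => by fun_prop) (fun l => freq a b l ^ 2 * ((b - a) / 2)) (fun l m => ?_), sineEnergy,
    Finset.mul_sum]
  · exact Finset.sum_congr rfl fun l _ => by ring
  · have h1 : ∀ x, freq a b l * Real.cos (freq a b l * (x - a)) *
        (freq a b m * Real.cos (freq a b m * (x - a)))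
        = freq a b l * freq a b m *
          (Real.cos (freq a b l * (x - a)) * Real.cos (freq a b m * (x - a))) := fun x => by ring
    simp only [h1]
    rw [intervalIntegral.integral_const_mul,
      integral_cos_mul_cos hab (Finset.mem_Ico.1 l.2).1 (Finset.mem_Ico.1 m.2).1]
    simp only [Subtype.ext_iff]
    split_ifs with h
    · rw [h]; ring
    · simp

theorem hasEnergyDensity_sineSynth (hab : a ≤ b) (d : SineCoeffs N) :
    HasEnergyDensity a b (sineSynth a b d) (fun x => ‖sineSynthDeriv a b d x‖ ^ 2) := by
  refine hasEnergyDensity_of_sub_eq_integral hab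
    (hasWeakDerivL2_of_hasDerivAt (hasDerivAt_sineSynth d) (continuous_sineSynthDeriv d)).1
    fun x _ => ?_
  rw [intervalIntegral.integral_eq_sub_of_hasDerivAt (fun y _ => hasDerivAt_sineSynth d y)
    ((continuous_sineSynthDeriv d).intervalIntegrable _ _)]

/-! ### Values of sine polynomials on the grid -/

theorem freq_mul_gridPoint_sub (hab : a < b) (l j : ℕ) :
    freq a b l * (gridPoint a b N j - a) = j * Real.pi * l / N := by
  have : b - a ≠ 0 := (sub_pos.2 hab).ne'
  rw [freq, gridPoint, meshSize]
  field_simp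
  ring

theorem sineVec_sub (w v : ℕ → ℂ) : sineVec N (fun j => w j - v j) = sineVec N w - sineVec N v := by
  ext l
  simp [sineVec, sineCoeff, sub_mul, mul_sub]

theorem sineVec_smul (c : ℂ) (w : ℕ → ℂ) : sineVec N (fun j => c * w j) = c • sineVec N w := by
  ext l
  simp only [sineVec, sineCoeff, PiLp.smul_apply, smul_eq_mul, mul_assoc, ← Finset.mul_sum]
  ring

theorem sq_norm_sineVec (w : ℕ → ℂ) :
    ‖sineVec N w‖ ^ 2 = 2 / N * ∑ j ∈ Finset.Ico 1 N, ‖w j‖ ^ 2 := by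
  rcases Nat.eq_zero_or_pos N with rfl | hN
  · have : IsEmpty (Finset.Ico 1 0) := ⟨fun l => by simpa using l.2⟩
    rw [EuclideanSpace.norm_sq_eq, Fintype.sum_empty]
    simp
  have hN0 : (N : ℝ) ≠ 0 := by positivity
  rw [EuclideanSpace.norm_sq_eq]
  have h1 : ∀ l : Finset.Ico 1 N, ‖sineVec N w l‖ ^ 2 = (2 / N) ^ 2 *
      ‖∑ j : Finset.Ico 1 N, w j * (Real.sin (l * Real.pi * j / N) : ℂ)‖ ^ 2 := fun l => by
    simp only [sineVec, sineCoeff]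
    rw [norm_mul, mul_pow, ← Finset.sum_coe_sort]
    congr 2
    · simp
    · congr 1
      refine Finset.sum_congr rfl fun j _ => ?_
      congr 3
      ring
  rw [Finset.sum_congr rfl fun l _ => h1 l, ← Finset.mul_sum,
    Finset.sum_coe_sort (Finset.Ico 1 N) (fun l : ℕ =>
      ‖∑ j : Finset.Ico 1 N, w j * (Real.sin (l * Real.pi * j / N) : ℂ)‖ ^ 2),
    sum_sq_norm_sum_mul (Finset.Ico 1 N)
      (fun (l : ℕ) (j : Finset.Ico 1 N) => Real.sin (l * Real.pi * j / N))
      (fun _ => (N : ℝ) / 2) (fun l m => ?_) (fun j => w j),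
    ← Finset.mul_sum, Finset.sum_coe_sort (Finset.Ico 1 N) (fun j : ℕ => ‖w j‖ ^ 2)]
  · field_simp
  · rw [sum_sin_mul_sin l.2 m.2]
    simp only [Subtype.ext_iff]

theorem sineVec_sineSynth (hab : a < b) (d : SineCoeffs N) :
    sineVec N (fun j => sineSynth a b d (gridPoint a b N j)) = d := by
  ext l
  have hN : (N : ℂ) ≠ 0 := by
    have := Finset.mem_Ico.1 l.2
    have : N ≠ 0 := by omega
    exact_mod_cast this
  simp only [sineVec, sineCoeff, sineSynth, freq_mul_gridPoint_sub hab, Finset.sum_mul]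
  rw [Finset.sum_comm]
  have h1 : ∀ m : Finset.Ico 1 N, ∑ j ∈ Finset.Ico 1 N,
      d m * (Real.sin (j * Real.pi * m / N) : ℂ) * (Real.sin (j * Real.pi * l / N) : ℂ)
      = if m = l then d m * (N / 2) else 0 := fun m => by
    have h2 := congrArg (Complex.ofReal) (sum_sin_mul_sin m.2 l.2)
    rw [Complex.ofReal_sum] at h2
    simp only [mul_assoc, ← Finset.mul_sum]
    simp only [Complex.ofReal_mul, mul_assoc] at h2
    rw [h2]
    simp only [Subtype.ext_iff]
    split_ifs <;> simp
  rw [Finset.sum_congr rfl fun m _ => h1 m]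
  simp only [Finset.sum_ite_eq', Finset.mem_univ, if_true]
  field_simp

/-- The sine interpolation reproduces the values at the inner grid points. -/
theorem sineSynth_sineVec_gridPoint (hab : a < b) (w : ℕ → ℂ) {j : ℕ} (hj : j ∈ Finset.Ico 1 N) :
    sineSynth a b (sineVec N w) (gridPoint a b N j) = w j := by
  have hz : ‖sineVec N fun i =>
      sineSynth a b (sineVec N w) (gridPoint a b N i) - w i‖ ^ 2 = 0 := by
    rw [sineVec_sub, sineVec_sineSynth hab, sub_self]
    simp
  have hN : (2 / N : ℝ) ≠ 0 := by
    have := Finset.mem_Ico.1 hj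
    have : (N : ℝ) ≠ 0 := by
      have : N ≠ 0 := by omega
      exact_mod_cast this
    positivity
  rw [sq_norm_sineVec, mul_eq_zero, or_iff_right hN,
    Finset.sum_eq_zero_iff_of_nonneg fun _ _ => by positivity] at hz
  have := hz j hj
  rwa [sq_eq_zero_iff, norm_eq_zero, sub_eq_zero] at this

theorem sineSynth_gridPoint_succ_sub (hab : a < b) (d : SineCoeffs N) (j : ℕ) :
    sineSynth a b d (gridPoint a b N (j + 1)) - sineSynth a b d (gridPoint a b N j)
      = ∑ l : Finset.Ico 1 N, d l * ((2 * Real.sin (Real.pi * l / (2 * N)) *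
          Real.cos ((j + 1 / 2) * (Real.pi * l / N)) : ℝ) : ℂ) := by
  simp only [sineSynth, freq_mul_gridPoint_sub hab]
  rw [← Finset.sum_sub_distrib]
  refine Finset.sum_congr rfl fun l _ => ?_
  rw [← mul_sub, ← Complex.ofReal_sub]
  congr 2
  push_cast
  rw [show ((j : ℝ) + 1) * Real.pi * l / N
      = (j + 1 / 2) * (Real.pi * l / N) + Real.pi * l / (2 * N) by field_simp; ring,
    show (j : ℝ) * Real.pi * l / N
      = (j + 1 / 2) * (Real.pi * l / N) - Real.pi * l / (2 * N) by field_simp; ring,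
    Real.sin_add, Real.sin_sub]
  ring

/-- The discrete `H¹` seminorm of a sine polynomial controls the continuous one. -/
theorem sineEnergy_le_sum (hab : a < b) (d : SineCoeffs N) :
    2 * meshSize a b N ^ 2 * N * sineEnergy a b d ≤ Real.pi ^ 2 * ∑ j ∈ Finset.range N,
      ‖sineSynth a b d (gridPoint a b N (j + 1)) - sineSynth a b d (gridPoint a b N j)‖ ^ 2 := by
  simp only [sineSynth_gridPoint_succ_sub hab]
  rw [sum_sq_norm_sum_mul (Finset.range N)
    (fun (j : ℕ) (l : Finset.Ico 1 N) => 2 * Real.sin (Real.pi * l / (2 * N)) *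
          Real.cos ((j + 1 / 2) * (Real.pi * l / N)))
    (fun l => (2 * Real.sin (Real.pi * l / (2 * N))) ^ 2 * (N / 2)) (fun l m => ?_)]
  · rw [sineEnergy, Finset.mul_sum, Finset.mul_sum]
    refine Finset.sum_le_sum fun l _ => ?_
    have hl := Finset.mem_Ico.1 l.2
    have hN : 0 < (N : ℝ) := by
      have : 0 < N := by omega
      exact_mod_cast this
    have hlN : ((l : ℕ) : ℝ) ≤ N := by exact_mod_cast hl.2.le
    have hpi := Real.pi_pos
    have hpos : 0 < b - a := sub_pos.2 hab
    -- Jordan's inequality `2 / π * x ≤ sin x` on `[0, π / 2]`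
    have hs := Real.mul_le_sin (x := Real.pi * l / (2 * N)) (by positivity) (by
      rw [div_le_div_iff₀ (by positivity) (by positivity)]
      nlinarith)
    have hs0 : 0 ≤ 2 / Real.pi * (Real.pi * l / (2 * N)) := by positivity
    have hs2 : (2 / Real.pi * (Real.pi * l / (2 * N))) ^ 2
        ≤ Real.sin (Real.pi * l / (2 * N)) ^ 2 := by gcongr
    have e : meshSize a b N ^ 2 * freq a b l ^ 2
        = Real.pi ^ 2 * (2 / Real.pi * (Real.pi * l / (2 * N))) ^ 2 := by
      rw [meshSize, freq]
      field_simp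
    calc 2 * meshSize a b N ^ 2 * N * (freq a b l ^ 2 * ‖d l‖ ^ 2)
        = 2 * N * ‖d l‖ ^ 2 * (meshSize a b N ^ 2 * freq a b l ^ 2) := by ring
      _ ≤ 2 * N * ‖d l‖ ^ 2 * (Real.pi ^ 2 * Real.sin (Real.pi * l / (2 * N)) ^ 2) := by
        rw [e]; gcongr
      _ = _ := by ring
  · have h1 : ∀ j ∈ Finset.range N, 2 * Real.sin (Real.pi * l / (2 * N)) *
          Real.cos ((j + 1 / 2) * (Real.pi * l / N)) * (2 * Real.sin (Real.pi * m / (2 * N)) *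
          Real.cos ((j + 1 / 2) * (Real.pi * m / N)))
        = (2 * Real.sin (Real.pi * l / (2 * N))) * (2 * Real.sin (Real.pi * m / (2 * N))) *
          (Real.cos ((j + 1 / 2) * (Real.pi * l / N)) *
            Real.cos ((j + 1 / 2) * (Real.pi * m / N))) := fun j _ => by ring
    rw [Finset.sum_congr rfl h1, ← Finset.mul_sum, sum_cos_mul_cos l.2 m.2]
    simp only [Subtype.ext_iff]
    split_ifs with h
    · rw [h]; ring
    · simp

end SineSpace

/-! ### The error of sine interpolation -/

section Interpolation

variable {a b : ℝ} {N : ℕ} {u : ℝ → ℂ} {Q : ℝ → ℝ}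

/-- The sine coefficients of the interpolant of a function. -/
def gridVec (a b : ℝ) (N : ℕ) (u : ℝ → ℂ) : SineCoeffs N :=
  sineVec N fun j => u (gridPoint a b N j)

theorem sineSynth_gridVec (hab : a < b) (ha : u a = 0) (hb : u b = 0) {j : ℕ} (hj : j ≤ N)
    (hN : 1 ≤ N) : sineSynth a b (gridVec a b N u) (gridPoint a b N j) = u (gridPoint a b N j) := by
  rcases Nat.eq_zero_or_pos j with rfl | hj0
  · rw [gridPoint_zero, sineSynth_left, ha]
  rcases hj.eq_or_lt with rfl | hlt
  · rw [gridPoint_self a b hN, hb, sineSynth]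
    refine Finset.sum_eq_zero fun l _ => ?_
    have : freq a b l * (b - a) = (l : ℕ) * Real.pi := by
      have := (sub_pos.2 hab).ne'
      rw [freq]
      field_simp
    rw [this, Real.sin_nat_mul_pi]
    simp
  · exact sineSynth_sineVec_gridPoint hab _ (Finset.mem_Ico.2 ⟨hj0, hlt⟩)

/-- Sine interpolation is stable in `H¹₀`. -/
theorem sineEnergy_gridVec_le (hab : a < b) (hN : 1 ≤ N) (h : HasEnergyDensity a b u Q)
    (ha : u a = 0) (hb : u b = 0) :
    (b - a) / 2 * sineEnergy a b (gridVec a b N u) ≤ 5 / 2 * ∫ x in a..b, Q x := by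
  have h1 := sineEnergy_le_sum hab (gridVec a b N u)
  have h2 : ∑ j ∈ Finset.range N, ‖sineSynth a b (gridVec a b N u) (gridPoint a b N (j + 1))
      - sineSynth a b (gridVec a b N u) (gridPoint a b N j)‖ ^ 2
      ≤ meshSize a b N * ∫ x in a..b, Q x := by
    refine le_trans (le_of_eq ?_) (h.sum_sq_norm_gridPoint_sub_le hab.le hN)
    refine Finset.sum_congr rfl fun j hj => ?_
    rw [Finset.mem_range] at hj
    rw [sineSynth_gridVec hab ha hb hj hN, sineSynth_gridVec hab ha hb hj.le hN]
  have hN0 : 0 < (N : ℝ) := by positivity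
  have hpos : 0 < b - a := sub_pos.2 hab
  have hm : meshSize a b N * N = b - a := by rw [meshSize]; field_simp
  have hm0 : 0 < meshSize a b N := by rw [meshSize]; positivity
  have hI := h.integral_nonneg hab.le
  have hpi : Real.pi ^ 2 ≤ 10 := by nlinarith [Real.pi_lt_d2, Real.pi_pos]
  have h3 : meshSize a b N * (2 * (b - a) * sineEnergy a b (gridVec a b N u))
      ≤ meshSize a b N * (10 * ∫ x in a..b, Q x) := by
    calc _ = 2 * meshSize a b N ^ 2 * N * sineEnergy a b (gridVec a b N u) := by rw [← hm]; ring
      _ ≤ Real.pi ^ 2 * (meshSize a b N * ∫ x in a..b, Q x) := h1.trans (by gcongr)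
      _ ≤ 10 * (meshSize a b N * ∫ x in a..b, Q x) := by gcongr
      _ = _ := by ring
  have h4 := le_of_mul_le_mul_left h3 hm0
  linarith

/-- First order of convergence of the sine interpolation in `L²`, for functions in `H¹₀`. -/
theorem integral_sq_norm_sub_gridVec_le (hab : a < b) (hN : 1 ≤ N) (hu : ContinuousOn u (Icc a b))
    (h : HasEnergyDensity a b u Q) (ha : u a = 0) (hb : u b = 0) :
    ∫ x in a..b, ‖u x - sineSynth a b (gridVec a b N u) x‖ ^ 2
      ≤ 7 * meshSize a b N ^ 2 * ∫ x in a..b, Q x := by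
  have hS := hasEnergyDensity_sineSynth hab.le (gridVec a b N u)
  have hd := h.of_norm_sub_le hS 1 1 (w := fun x => u x - sineSynth a b (gridVec a b N u) x)
    fun x _ y _ => by
      rw [sub_sub_sub_comm, one_mul, one_mul]
      exact norm_sub_le _ _
  have h1 := hd.integral_sq_norm_le hab.le hN (hu.sub (continuous_sineSynth _).continuousOn)
    fun j hj => by rw [sineSynth_gridVec hab ha hb hj.le hN, sub_self]
  rw [h.integral_weighted_add hS, integral_sq_norm_sineSynthDeriv hab] at h1
  have h2 := sineEnergy_gridVec_le hab hN h ha hb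
  calc _ ≤ meshSize a b N ^ 2 * (2 * 1 ^ 2 * (∫ x in a..b, Q x)
        + 2 * 1 ^ 2 * ((b - a) / 2 * sineEnergy a b (gridVec a b N u))) := h1
    _ ≤ meshSize a b N ^ 2 * (7 * ∫ x in a..b, Q x) := by
      gcongr
      linarith
    _ = _ := by ring

end Interpolation

/-! ### Truncated sine series -/

section Bessel

variable {a b : ℝ} {N : ℕ} {u : ℝ → ℂ}

theorem integral_sq_norm_sub_sineSynth (hab : a < b) (hu : ContinuousOn u (Icc a b))
    (d : SineCoeffs N) :
    ∫ x in a..b, ‖u x - sineSynth a b d x‖ ^ 2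
      = (∫ x in a..b, ‖u x‖ ^ 2) - (b - a) / 2 * ‖fourierVec a b N u‖ ^ 2
        + (b - a) / 2 * ‖fourierVec a b N u - d‖ ^ 2 := by
  have hpos : b - a ≠ 0 := (sub_pos.2 hab).ne'
  have hS := continuous_sineSynth (a := a) (b := b) d
  have hu' : ContinuousOn u (uIcc a b) := by rwa [uIcc_of_le hab.le]
  have hinner : ∫ x in a..b, inner ℂ (sineSynth a b d x) (u x)
      = ((b - a) / 2 : ℝ) * inner ℂ d (fourierVec a b N u) := by
    have h1 : ∀ x, inner ℂ (sineSynth a b d x) (u x) = ∑ l : Finset.Ico 1 N,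
        (starRingEnd ℂ) (d l) * (u x * (Real.sin (freq a b l * (x - a)) : ℂ)) := fun x => by
      rw [RCLike.inner_apply, sineSynth, map_sum, Finset.mul_sum]
      refine Finset.sum_congr rfl fun l _ => ?_
      rw [map_mul, Complex.conj_ofReal]
      ring
    simp only [h1]
    rw [intervalIntegral.integral_finsetSum, PiLp.inner_apply, Finset.mul_sum]
    · refine Finset.sum_congr rfl fun l _ => ?_
      rw [intervalIntegral.integral_const_mul, RCLike.inner_apply]
      simp only [fourierVec]
      rw [mul_comm _ ((starRingEnd ℂ) (d l)), mul_left_comm, ← mul_assoc (((b - a) / 2 : ℝ) : ℂ),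
        ← Complex.ofReal_mul, show (b - a) / 2 * (2 / (b - a)) = 1 by field_simp,
        Complex.ofReal_one, one_mul]
    · intro l _
      refine ContinuousOn.intervalIntegrable ?_
      exact continuousOn_const.mul (hu'.mul (Continuous.continuousOn (by fun_prop)))
  have hre : ∫ x in a..b, (inner ℂ (sineSynth a b d x) (u x)).re
      = (b - a) / 2 * (inner ℂ d (fourierVec a b N u)).re := by
    have hii : IntervalIntegrable (fun x => inner ℂ (sineSynth a b d x) (u x)) volume a b :=
      (hS.continuousOn.inner (𝕜 := ℂ) hu').intervalIntegrable
    have h2 := Complex.reCLM.intervalIntegral_comp_comm hii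
    simp only [Complex.reCLM_apply] at h2
    rw [h2, hinner, Complex.re_ofReal_mul]
  have e : ∀ x, ‖u x - sineSynth a b d x‖ ^ 2
      = ‖u x‖ ^ 2 - 2 * (inner ℂ (sineSynth a b d x) (u x)).re + ‖sineSynth a b d x‖ ^ 2 :=
    fun x => by
      rw [norm_sub_rev, norm_sub_sq (𝕜 := ℂ)]
      simp only [RCLike.re_to_complex]
      ring
  simp only [e]
  have i1 : IntervalIntegrable (fun x => ‖u x‖ ^ 2) volume a b :=
    (hu'.norm.pow 2).intervalIntegrable
  have i2 : IntervalIntegrable (fun x => 2 * (inner ℂ (sineSynth a b d x) (u x)).re) volume a b :=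
    (continuousOn_const.mul (Complex.continuous_re.comp_continuousOn
      (hS.continuousOn.inner (𝕜 := ℂ) hu'))).intervalIntegrable
  have i3 : IntervalIntegrable (fun x => ‖sineSynth a b d x‖ ^ 2) volume a b :=
    (hS.norm.pow 2).intervalIntegrable _ _
  rw [intervalIntegral.integral_add (i1.sub i2) i3, intervalIntegral.integral_sub i1 i2,
    intervalIntegral.integral_const_mul, hre, integral_sq_norm_sineSynth hab,
    norm_sub_rev (fourierVec a b N u) d, norm_sub_sq (𝕜 := ℂ)]
  simp only [RCLike.re_to_complex]
  ring

/-- Bessel's inequality, applied to `u` minus a sine polynomial. -/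
theorem sq_norm_fourierVec_sub_le (hab : a < b) (hu : ContinuousOn u (Icc a b))
    (d : SineCoeffs N) :
    (b - a) / 2 * ‖fourierVec a b N u - d‖ ^ 2 ≤ ∫ x in a..b, ‖u x - sineSynth a b d x‖ ^ 2 := by
  have h1 := integral_sq_norm_sub_sineSynth hab hu d
  have h2 := integral_sq_norm_sub_sineSynth hab hu (fourierVec a b N u)
  have h3 : 0 ≤ ∫ x in a..b, ‖u x - sineSynth a b (fourierVec a b N u) x‖ ^ 2 :=
    intervalIntegral.integral_nonneg hab.le fun x _ => by positivity
  rw [sub_self, norm_zero] at h2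
  linarith

theorem sq_norm_fourierVec_le (hab : a < b) (hu : ContinuousOn u (Icc a b)) :
    (b - a) / 2 * ‖fourierVec a b N u‖ ^ 2 ≤ ∫ x in a..b, ‖u x‖ ^ 2 := by
  simpa [sineSynth] using sq_norm_fourierVec_sub_le hab hu (0 : SineCoeffs N)

/-- The truncated sine series is the best approximation; the error of any other sine polynomial
exceeds that of a competitor at most by its distance to the truncated series. -/
theorem integral_sq_norm_sub_sineSynth_le (hab : a < b) (hu : ContinuousOn u (Icc a b))
    (d e : SineCoeffs N) :
    ∫ x in a..b, ‖u x - sineSynth a b d x‖ ^ 2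
      ≤ (∫ x in a..b, ‖u x - sineSynth a b e x‖ ^ 2)
        + (b - a) / 2 * ‖fourierVec a b N u - d‖ ^ 2 := by
  rw [integral_sq_norm_sub_sineSynth hab hu d, integral_sq_norm_sub_sineSynth hab hu e]
  have : 0 ≤ (b - a) / 2 * ‖fourierVec a b N u - e‖ ^ 2 := by
    have := sub_pos.2 hab
    positivity
  linarith

theorem fourierVec_sub (hab : a ≤ b) {v : ℝ → ℂ} (hu : ContinuousOn u (Icc a b))
    (hv : ContinuousOn v (Icc a b)) :
    fourierVec a b N (fun x => u x - v x) = fourierVec a b N u - fourierVec a b N v := by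
  have hi : ∀ {w : ℝ → ℂ} (_ : ContinuousOn w (Icc a b)) (l : ℕ), IntervalIntegrable
      (fun x => w x * (Real.sin (freq a b l * (x - a)) : ℂ)) volume a b := fun {w} hw l => by
    refine ContinuousOn.intervalIntegrable ?_
    rw [uIcc_of_le hab]
    exact hw.mul (Continuous.continuousOn (by fun_prop))
  ext l
  simp only [fourierVec, PiLp.sub_apply, sub_mul]
  rw [intervalIntegral.integral_sub (hi hu l) (hi hv l), mul_sub]

end Bessel

/-! ### The pointwise nonlinearity and its flow -/

section PointwiseNonlinearity

/-- The tangent inequality of the concave function `r ↦ r ^ p`, multiplied by `s` so that the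
singularity of its derivative at `0` cancels. -/
theorem rpow_sub_mul_le {p r s : ℝ} (hp0 : 0 < p) (hp1 : p ≤ 1) (hs : 0 ≤ s) (hsr : s ≤ r) :
    (r ^ p - s ^ p) * s ≤ s ^ p * (r - s) := by
  rcases hs.eq_or_lt with rfl | hs0
  · simp [Real.zero_rpow hp0.ne']
  have hr0 : 0 < r := hs0.trans_le hsr
  have h1 : s = s ^ p * s ^ (1 - p) := by
    rw [← Real.rpow_add hs0, add_sub_cancel, Real.rpow_one]
  have h2 : r = r ^ p * r ^ (1 - p) := by
    rw [← Real.rpow_add hr0, add_sub_cancel, Real.rpow_one]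
  have h3 : s ^ (1 - p) ≤ r ^ (1 - p) := Real.rpow_le_rpow hs hsr (by linarith)
  have h4 : r ^ p * s ≤ s ^ p * r := by
    calc r ^ p * s = r ^ p * s ^ p * s ^ (1 - p) := by rw [mul_assoc, ← h1]
      _ ≤ r ^ p * s ^ p * r ^ (1 - p) := by gcongr
      _ = s ^ p * r := by rw [mul_comm (r ^ p), mul_assoc, ← h2]
  linarith

variable {β σ : ℝ}

theorem nonlin_sq (β σ : ℝ) {r : ℝ} (hr : 0 ≤ r) : nonlin β σ (r ^ 2) = β * r ^ (2 * σ) := by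
  rw [nonlin, ← Real.rpow_natCast, ← Real.rpow_mul hr]
  norm_num

/-- For exponents `2σ ≤ 1` the increment of the potential `β |z|^{2σ}`, multiplied by the smaller
of the two moduli, is controlled by that smaller modulus alone. -/
theorem abs_nonlin_sub_mul_le (hσ : 0 < σ) (hσ' : σ ≤ 1 / 2) {z w : ℂ} {R : ℝ} (hwz : ‖w‖ ≤ ‖z‖)
    (hw : ‖w‖ ≤ R) :
    |nonlin β σ (‖z‖ ^ 2) - nonlin β σ (‖w‖ ^ 2)| * ‖w‖ ≤ |β| * R ^ (2 * σ) * ‖z - w‖ := by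
  have hmono : ‖w‖ ^ (2 * σ) ≤ ‖z‖ ^ (2 * σ) :=
    Real.rpow_le_rpow (norm_nonneg _) hwz (by linarith)
  have hR : ‖w‖ ^ (2 * σ) ≤ R ^ (2 * σ) := Real.rpow_le_rpow (norm_nonneg _) hw (by linarith)
  rw [nonlin_sq _ _ (norm_nonneg _), nonlin_sq _ _ (norm_nonneg _), ← mul_sub, abs_mul,
    abs_of_nonneg (sub_nonneg.2 hmono), mul_assoc, mul_assoc]
  refine mul_le_mul_of_nonneg_left ?_ (abs_nonneg _)
  calc _ ≤ ‖w‖ ^ (2 * σ) * (‖z‖ - ‖w‖) :=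
        rpow_sub_mul_le (by linarith) (by linarith) (norm_nonneg _) hwz
    _ ≤ R ^ (2 * σ) * ‖z - w‖ := by
        refine mul_le_mul hR (norm_sub_norm_le _ _) (sub_nonneg.2 hwz)
          (Real.rpow_nonneg ((norm_nonneg _).trans hw) _)

theorem abs_nonlin_le (hσ : 0 < σ) {z : ℂ} {R : ℝ} (hz : ‖z‖ ≤ R) :
    |nonlin β σ (‖z‖ ^ 2)| ≤ |β| * R ^ (2 * σ) := by
  rw [nonlin_sq _ _ (norm_nonneg _), abs_mul, abs_of_nonneg (Real.rpow_nonneg (norm_nonneg _) _)]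
  exact mul_le_mul_of_nonneg_left (Real.rpow_le_rpow (norm_nonneg _) hz (by linarith))
    (abs_nonneg _)

theorem norm_nonlin_mul_sub_le (hσ : 0 < σ) (hσ' : σ ≤ 1 / 2) {z w : ℂ} {R : ℝ} (hz : ‖z‖ ≤ R)
    (hw : ‖w‖ ≤ R) :
    ‖(nonlin β σ (‖z‖ ^ 2) : ℂ) * z - (nonlin β σ (‖w‖ ^ 2) : ℂ) * w‖
      ≤ 2 * |β| * R ^ (2 * σ) * ‖z - w‖ := by
  wlog hwz : ‖w‖ ≤ ‖z‖ generalizing z w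
  · rw [norm_sub_rev, norm_sub_rev z w]
    exact this hw hz (le_of_not_ge hwz)
  have e : (nonlin β σ (‖z‖ ^ 2) : ℂ) * z - (nonlin β σ (‖w‖ ^ 2) : ℂ) * w
      = (nonlin β σ (‖z‖ ^ 2) : ℂ) * (z - w)
        + ((nonlin β σ (‖z‖ ^ 2) - nonlin β σ (‖w‖ ^ 2) : ℝ) : ℂ) * w := by
    push_cast; ring
  rw [e]
  refine (norm_add_le _ _).trans ?_
  rw [norm_mul, norm_mul, Complex.norm_real, Complex.norm_real, Real.norm_eq_abs, Real.norm_eq_abs]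
  have h1 := abs_nonlin_sub_mul_le (β := β) hσ hσ' hwz hw
  have h2 := mul_le_mul_of_nonneg_right (abs_nonlin_le (β := β) hσ hz) (norm_nonneg (z - w))
  linarith

/-- The flow `z ↦ exp(-i τ (v + f(|z|²))) z` of the pointwise substep. -/
def phaseFlow (β σ τ v : ℝ) (z : ℂ) : ℂ :=
  Complex.exp (-Complex.I * ((τ * (v + nonlin β σ (‖z‖ ^ 2)) : ℝ) : ℂ)) * z

theorem norm_exp_neg_I_mul (x : ℝ) : ‖Complex.exp (-Complex.I * (x : ℂ))‖ = 1 := by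
  rw [show -Complex.I * (x : ℂ) = ((-x : ℝ) : ℂ) * Complex.I by push_cast; ring]
  exact Complex.norm_exp_ofReal_mul_I _

theorem norm_exp_I_mul_sub_one_le (x : ℝ) : ‖Complex.exp (Complex.I * (x : ℂ)) - 1‖ ≤ |x| :=
  Real.norm_exp_I_mul_ofReal_sub_one_le

theorem norm_exp_neg_I_mul_sub_one_le (x : ℝ) :
    ‖Complex.exp (-Complex.I * (x : ℂ)) - 1‖ ≤ |x| := by
  have := norm_exp_I_mul_sub_one_le (-x)
  rw [abs_neg] at this
  rwa [show -Complex.I * (x : ℂ) = Complex.I * ((-x : ℝ) : ℂ) by push_cast; ring]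

theorem norm_exp_neg_I_mul_sub_le (x y : ℝ) :
    ‖Complex.exp (-Complex.I * (x : ℂ)) - Complex.exp (-Complex.I * (y : ℂ))‖ ≤ |x - y| := by
  have e : Complex.exp (-Complex.I * (x : ℂ)) - Complex.exp (-Complex.I * (y : ℂ))
      = Complex.exp (-Complex.I * (y : ℂ)) * (Complex.exp (-Complex.I * ((x - y : ℝ) : ℂ)) - 1) := by
    rw [mul_sub, ← Complex.exp_add, mul_one]
    congr 2
    push_cast; ring
  rw [e, norm_mul, norm_exp_neg_I_mul, one_mul]
  exact norm_exp_neg_I_mul_sub_one_le _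

theorem norm_exp_neg_I_mul_sub_one_add_le (x : ℝ) :
    ‖Complex.exp (-Complex.I * (x : ℂ)) - 1 + Complex.I * x‖ ≤ 2 * x ^ 2 := by
  have hn : ‖-Complex.I * (x : ℂ)‖ = |x| := by simp
  rcases le_or_gt |x| 1 with h | h
  · have h1 := Complex.norm_exp_sub_one_sub_id_le (x := -Complex.I * (x : ℂ)) (by rwa [hn])
    rw [hn, sq_abs, neg_mul, sub_neg_eq_add, ← neg_mul] at h1
    nlinarith [sq_nonneg x]
  · have h1 := norm_add_le (Complex.exp (-Complex.I * (x : ℂ)) - 1) (Complex.I * x)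
    have h2 := norm_exp_neg_I_mul_sub_one_le x
    have h3 : ‖Complex.I * (x : ℂ)‖ = |x| := by simp
    rw [h3] at h1
    nlinarith [sq_abs x]

variable {τ v R Vm : ℝ} {z w : ℂ}

theorem norm_phase_sub_mul_le (hσ : 0 < σ) (hσ' : σ ≤ 1 / 2) (hτ : 0 ≤ τ) (hwz : ‖w‖ ≤ ‖z‖)
    (hw : ‖w‖ ≤ R) :
    ‖(Complex.exp (-Complex.I * ((τ * (v + nonlin β σ (‖z‖ ^ 2)) : ℝ) : ℂ))
      - Complex.exp (-Complex.I * ((τ * (v + nonlin β σ (‖w‖ ^ 2)) : ℝ) : ℂ))) * w‖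
      ≤ τ * (|β| * R ^ (2 * σ)) * ‖z - w‖ := by
  rw [norm_mul]
  have h1 := norm_exp_neg_I_mul_sub_le (τ * (v + nonlin β σ (‖z‖ ^ 2)))
    (τ * (v + nonlin β σ (‖w‖ ^ 2)))
  rw [← mul_sub, add_sub_add_left_eq_sub, abs_mul, abs_of_nonneg hτ] at h1
  calc _ ≤ τ * |nonlin β σ (‖z‖ ^ 2) - nonlin β σ (‖w‖ ^ 2)| * ‖w‖ := by gcongr
    _ = τ * (|nonlin β σ (‖z‖ ^ 2) - nonlin β σ (‖w‖ ^ 2)| * ‖w‖) := by ring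
    _ ≤ τ * (|β| * R ^ (2 * σ) * ‖z - w‖) :=
      mul_le_mul_of_nonneg_left (abs_nonlin_sub_mul_le hσ hσ' hwz hw) hτ
    _ = _ := by ring

/-- Stability of the pointwise substep. Only one of the two arguments has to be bounded, which
makes the scheme stable without any a priori bound on the numerical solution. -/
theorem norm_phaseFlow_sub_le (hσ : 0 < σ) (hσ' : σ ≤ 1 / 2) (hτ : 0 ≤ τ) (hw : ‖w‖ ≤ R) :
    ‖phaseFlow β σ τ v z - phaseFlow β σ τ v w‖ ≤ (1 + τ * (|β| * R ^ (2 * σ))) * ‖z - w‖ := by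
  have key : ∀ z w : ℂ, ‖w‖ ≤ ‖z‖ → ‖w‖ ≤ R →
      ‖phaseFlow β σ τ v z - phaseFlow β σ τ v w‖
        ≤ (1 + τ * (|β| * R ^ (2 * σ))) * ‖z - w‖ := fun z w hwz hw => by
    have e : phaseFlow β σ τ v z - phaseFlow β σ τ v w
        = Complex.exp (-Complex.I * ((τ * (v + nonlin β σ (‖z‖ ^ 2)) : ℝ) : ℂ)) * (z - w)
          + (Complex.exp (-Complex.I * ((τ * (v + nonlin β σ (‖z‖ ^ 2)) : ℝ) : ℂ))
      - Complex.exp (-Complex.I * ((τ * (v + nonlin β σ (‖w‖ ^ 2)) : ℝ) : ℂ))) * w := by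
      rw [phaseFlow, phaseFlow]; ring
    rw [e]
    refine (norm_add_le _ _).trans ?_
    rw [norm_mul (Complex.exp _) (z - w), norm_exp_neg_I_mul, add_mul]
    exact add_le_add le_rfl (norm_phase_sub_mul_le hσ hσ' hτ hwz hw)
  rcases le_total ‖w‖ ‖z‖ with h | h
  · exact key z w h hw
  · rw [norm_sub_rev, norm_sub_rev z w]
    exact key w z h (h.trans hw)

theorem abs_phase_le (hσ : 0 < σ) (hτ : 0 ≤ τ) (hv : |v| ≤ Vm) (hz : ‖z‖ ≤ R) :
    |τ * (v + nonlin β σ (‖z‖ ^ 2))| ≤ τ * (Vm + |β| * R ^ (2 * σ)) := by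
  rw [abs_mul, abs_of_nonneg hτ]
  gcongr
  exact (abs_add_le _ _).trans (add_le_add hv (abs_nonlin_le hσ hz))

theorem norm_phaseFlow_sub_self_sub_le (hσ : 0 < σ) (hσ' : σ ≤ 1 / 2) (hτ : 0 ≤ τ) (hv : |v| ≤ Vm)
    (hz : ‖z‖ ≤ R) (hw : ‖w‖ ≤ R) :
    ‖(phaseFlow β σ τ v z - z) - (phaseFlow β σ τ v w - w)‖
      ≤ τ * (Vm + 2 * |β| * R ^ (2 * σ)) * ‖z - w‖ := by
  wlog hwz : ‖w‖ ≤ ‖z‖ generalizing z w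
  · rw [norm_sub_rev, norm_sub_rev z w]
    exact this hw hz (le_of_not_ge hwz)
  have e : (phaseFlow β σ τ v z - z) - (phaseFlow β σ τ v w - w)
      = (Complex.exp (-Complex.I * ((τ * (v + nonlin β σ (‖z‖ ^ 2)) : ℝ) : ℂ)) - 1) * (z - w)
        + (Complex.exp (-Complex.I * ((τ * (v + nonlin β σ (‖z‖ ^ 2)) : ℝ) : ℂ))
      - Complex.exp (-Complex.I * ((τ * (v + nonlin β σ (‖w‖ ^ 2)) : ℝ) : ℂ))) * w := by
    rw [phaseFlow, phaseFlow]; ring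
  rw [e]
  refine (norm_add_le _ _).trans ?_
  rw [norm_mul (_ - 1) (z - w)]
  have h1 := (norm_exp_neg_I_mul_sub_one_le (τ * (v + nonlin β σ (‖z‖ ^ 2)))).trans
    (abs_phase_le (β := β) hσ hτ hv hz)
  have h2 := mul_le_mul_of_nonneg_right h1 (norm_nonneg (z - w))
  have h3 := norm_phase_sub_mul_le (β := β) (v := v) hσ hσ' hτ hwz hw
  linarith

theorem norm_phaseFlow_sub_self_add_le (hσ : 0 < σ) (hτ : 0 ≤ τ) (hv : |v| ≤ Vm) (hz : ‖z‖ ≤ R) :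
    ‖phaseFlow β σ τ v z - z
        + (τ * Complex.I) * (((v + nonlin β σ (‖z‖ ^ 2) : ℝ) : ℂ) * z)‖
      ≤ 2 * τ ^ 2 * (Vm + |β| * R ^ (2 * σ)) ^ 2 * R := by
  have e : phaseFlow β σ τ v z - z + (τ * Complex.I) * (((v + nonlin β σ (‖z‖ ^ 2) : ℝ) : ℂ) * z)
      = (Complex.exp (-Complex.I * ((τ * (v + nonlin β σ (‖z‖ ^ 2)) : ℝ) : ℂ)) - 1
        + Complex.I * ((τ * (v + nonlin β σ (‖z‖ ^ 2)) : ℝ) : ℂ)) * z := by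
    rw [phaseFlow]; push_cast; ring
  rw [e, norm_mul]
  have h1 := norm_exp_neg_I_mul_sub_one_add_le (τ * (v + nonlin β σ (‖z‖ ^ 2)))
  have h2 := abs_phase_le (β := β) hσ hτ hv hz
  have h3 : (τ * (v + nonlin β σ (‖z‖ ^ 2))) ^ 2 ≤ (τ * (Vm + |β| * R ^ (2 * σ))) ^ 2 := by
    rw [← sq_abs]; gcongr
  calc _ ≤ (2 * (τ * (Vm + |β| * R ^ (2 * σ))) ^ 2) * R :=
        mul_le_mul (h1.trans (by linarith)) hz (norm_nonneg _) (by positivity)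
    _ = _ := by ring

end PointwiseNonlinearity

/-! ### The free flow in sine coefficients -/

section FreeFlow

variable {a b : ℝ} {N : ℕ}

/-- The unitary group `exp(i r μ_l²)` acting on sine coefficients. The free Schrödinger flow over
the time `τ` is the member `r = -τ`. -/
def freeFlow (a b : ℝ) {N : ℕ} (r : ℝ) (d : SineCoeffs N) : SineCoeffs N :=
  WithLp.toLp 2 fun l => Complex.exp (Complex.I * ((r * freq a b l ^ 2 : ℝ) : ℂ)) * d l

theorem norm_exp_I_mul (x : ℝ) : ‖Complex.exp (Complex.I * (x : ℂ))‖ = 1 := by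
  rw [mul_comm]
  exact Complex.norm_exp_ofReal_mul_I _

theorem freeFlow_apply (r : ℝ) (d : SineCoeffs N) (l : Finset.Ico 1 N) :
    freeFlow a b r d l = Complex.exp (Complex.I * ((r * freq a b l ^ 2 : ℝ) : ℂ)) * d l := rfl

theorem freeFlow_sub (r : ℝ) (d e : SineCoeffs N) :
    freeFlow a b r (d - e) = freeFlow a b r d - freeFlow a b r e := by
  ext l
  simp [freeFlow_apply, mul_sub]

theorem norm_freeFlow (r : ℝ) (d : SineCoeffs N) : ‖freeFlow a b r d‖ = ‖d‖ := by
  rw [EuclideanSpace.norm_eq, EuclideanSpace.norm_eq]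
  simp only [freeFlow_apply, norm_mul, norm_exp_I_mul, one_mul]

theorem freeFlow_zero (d : SineCoeffs N) : freeFlow a b 0 d = d := by
  ext l
  simp [freeFlow_apply]

theorem freeFlow_neg_freeFlow (r : ℝ) (d : SineCoeffs N) :
    freeFlow a b (-r) (freeFlow a b r d) = d := by
  ext l
  rw [freeFlow_apply, freeFlow_apply, ← mul_assoc, ← Complex.exp_add]
  rw [show Complex.I * ((-r * freq a b l ^ 2 : ℝ) : ℂ) + Complex.I * ((r * freq a b l ^ 2 : ℝ) : ℂ)
    = 0 by push_cast; ring, Complex.exp_zero, one_mul]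

theorem norm_freeFlow_sub_self_le_two (r : ℝ) (d : SineCoeffs N) :
    ‖freeFlow a b r d - d‖ ≤ 2 * ‖d‖ := by
  have := norm_sub_le (freeFlow a b r d) d
  rw [norm_freeFlow] at this
  linarith

/-- The free flow is Hölder continuous in time with exponent `1/2` on `H¹`. -/
theorem sq_norm_freeFlow_sub_self_le {r : ℝ} (hr : 0 ≤ r) (d : SineCoeffs N) :
    ‖freeFlow a b r d - d‖ ^ 2 ≤ 2 * r * sineEnergy a b d := by
  rw [EuclideanSpace.norm_sq_eq, sineEnergy, Finset.mul_sum]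
  refine Finset.sum_le_sum fun l _ => ?_
  rw [PiLp.sub_apply, freeFlow_apply]
  set θ := r * freq a b l ^ 2 with hθ
  have hθ0 : 0 ≤ θ := by positivity
  have e : Complex.exp (Complex.I * (θ : ℂ)) * d l - d l
      = (Complex.exp (Complex.I * (θ : ℂ)) - 1) * d l := by ring
  have h1 := norm_exp_I_mul_sub_one_le θ
  rw [abs_of_nonneg hθ0] at h1
  have h2 : ‖Complex.exp (Complex.I * (θ : ℂ)) - 1‖ ≤ 2 := by
    refine (norm_sub_le _ _).trans ?_
    rw [norm_exp_I_mul, norm_one]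
    norm_num
  -- interpolate between the bounds `θ` and `2`
  have h3 : ‖Complex.exp (Complex.I * (θ : ℂ)) - 1‖ ^ 2 ≤ 2 * θ := by
    rw [sq]
    exact mul_le_mul h2 h1 (norm_nonneg _) (by norm_num)
  rw [e, norm_mul, mul_pow]
  calc _ ≤ 2 * θ * ‖d l‖ ^ 2 := by gcongr
    _ = _ := by rw [hθ]; ring

theorem sineVec_kineticStep (hab : a < b) (τ : ℝ) (w : ℕ → ℂ) :
    sineVec N (kineticStep a b τ N w) = freeFlow a b (-τ) (sineVec N w) := by
  rw [← sineVec_sineSynth hab (freeFlow a b (-τ) (sineVec N w))]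
  congr 1
  ext j
  rw [kineticStep, sineSynth, ← Finset.sum_coe_sort]
  refine Finset.sum_congr rfl fun l _ => ?_
  rw [freeFlow_apply]
  congr 2
  push_cast
  congr 1
  ring

theorem norm_sineVec_le_mul {w v : ℕ → ℂ} {A : ℝ} (hA : 0 ≤ A)
    (h : ∀ j ∈ Finset.Ico 1 N, ‖w j‖ ≤ A * ‖v j‖) : ‖sineVec N w‖ ≤ A * ‖sineVec N v‖ := by
  refine le_of_sq_le_sq ?_ (by positivity)
  rw [mul_pow, sq_norm_sineVec, sq_norm_sineVec, mul_left_comm, Finset.mul_sum (a := A ^ 2)]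
  gcongr with j hj
  rw [← mul_pow]
  gcongr
  exact h j hj

theorem norm_sineVec_le {w : ℕ → ℂ} {B : ℝ} (hB : 0 ≤ B)
    (h : ∀ j ∈ Finset.Ico 1 N, ‖w j‖ ≤ B) : ‖sineVec N w‖ ≤ 2 * B := by
  refine le_of_sq_le_sq ?_ (by positivity)
  rw [sq_norm_sineVec]
  rcases Nat.eq_zero_or_pos N with rfl | hN
  · simp; positivity
  have hN0 : 0 < (N : ℝ) := by positivity
  calc _ ≤ 2 / (N : ℝ) * ∑ j ∈ Finset.Ico 1 N, B ^ 2 := by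
        gcongr with j hj
        exact h j hj
    _ = 2 / (N : ℝ) * ((N - 1 : ℕ) * B ^ 2) := by simp
    _ ≤ 2 / (N : ℝ) * (N * B ^ 2) := by
        gcongr
        exact Nat.sub_le _ _
    _ = 2 * B ^ 2 := by field_simp
    _ ≤ _ := by nlinarith [sq_nonneg B]

end FreeFlow

/-! ### Bounded sets of `H¹₀` -/

section H10Bounded

variable {a b κ : ℝ} {N : ℕ} {u v : ℝ → ℂ}

/-- `u` belongs to `H¹₀(a, b)`, and the mean square of its derivative is at most `κ²`. -/
structure IsH10Bounded (a b : ℝ) (u : ℝ → ℂ) (κ : ℝ) : Prop where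
  continuousOn : ContinuousOn u (Icc a b)
  left_eq_zero : u a = 0
  right_eq_zero : u b = 0
  exists_density : ∃ Q, HasEnergyDensity a b u Q ∧ ∫ x in a..b, Q x ≤ (b - a) * κ ^ 2

theorem IsH10Bounded.norm_le (hab : a < b) (hκ : 0 ≤ κ) (h : IsH10Bounded a b u κ) {x : ℝ}
    (hx : x ∈ Icc a b) : ‖u x‖ ≤ (b - a) * κ := by
  have hpos := sub_pos.2 hab
  obtain ⟨Q, hQ, hI⟩ := h.exists_density
  have h1 := hQ.sq_norm_sub_le_total (left_mem_Icc.2 hab.le) hx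
  rw [h.left_eq_zero, sub_zero] at h1
  refine le_of_sq_le_sq ?_ (by positivity)
  calc ‖u x‖ ^ 2 ≤ (b - a) * ((b - a) * κ ^ 2) := h1.trans (by gcongr)
    _ = _ := by ring

theorem IsH10Bounded.sub (hu : IsH10Bounded a b u κ) (hv : IsH10Bounded a b v κ) :
    IsH10Bounded a b (fun x => u x - v x) (2 * κ) := by
  obtain ⟨Q, hQ, hI⟩ := hu.exists_density
  obtain ⟨R, hR, hJ⟩ := hv.exists_density
  refine ⟨hu.continuousOn.sub hv.continuousOn, ?_, ?_, _, hQ.of_norm_sub_le hR 1 1 fun x _ y _ => ?_,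
    ?_⟩
  · rw [hu.left_eq_zero, hv.left_eq_zero, sub_zero]
  · rw [hu.right_eq_zero, hv.right_eq_zero, sub_zero]
  · rw [sub_sub_sub_comm, one_mul, one_mul]
    exact norm_sub_le _ _
  · rw [hQ.integral_weighted_add hR]
    linarith

theorem IsH10Bounded.integral_sq_norm_sub_gridVec_le (hab : a < b) (hN : 1 ≤ N)
    (h : IsH10Bounded a b u κ) :
    ∫ x in a..b, ‖u x - sineSynth a b (gridVec a b N u) x‖ ^ 2
      ≤ 7 * meshSize a b N ^ 2 * ((b - a) * κ ^ 2) := by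
  obtain ⟨Q, hQ, hI⟩ := h.exists_density
  refine (NLS.integral_sq_norm_sub_gridVec_le hab hN h.continuousOn hQ h.left_eq_zero
    h.right_eq_zero).trans ?_
  gcongr

theorem IsH10Bounded.norm_fourierVec_sub_gridVec_le (hab : a < b) (hN : 1 ≤ N) (hκ : 0 ≤ κ)
    (h : IsH10Bounded a b u κ) :
    ‖fourierVec a b N u - gridVec a b N u‖ ≤ 4 * κ * meshSize a b N := by
  have hpos := sub_pos.2 hab
  have hm := meshSize_nonneg hab.le N
  refine le_of_sq_le_sq ?_ (by positivity)
  have h1 := (sq_norm_fourierVec_sub_le hab h.continuousOn (gridVec a b N u)).trans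
    (h.integral_sq_norm_sub_gridVec_le hab hN)
  have h2 : (b - a) / 2 * ‖fourierVec a b N u - gridVec a b N u‖ ^ 2
      ≤ (b - a) / 2 * (14 * (κ * meshSize a b N) ^ 2) := h1.trans (le_of_eq (by ring))
  have h3 := le_of_mul_le_mul_left h2 (by positivity)
  nlinarith [sq_nonneg (κ * meshSize a b N)]

/-- Hölder continuity in time of the free flow on the coefficients of an `H¹₀` function. Replacing
the Fourier coefficients by those of the interpolant costs the mesh size. -/
theorem IsH10Bounded.norm_freeFlow_fourierVec_sub_le (hab : a < b) (hN : 1 ≤ N) (hκ : 0 ≤ κ)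
    (h : IsH10Bounded a b u κ) {r : ℝ} (hr : 0 ≤ r) :
    ‖freeFlow a b r (fourierVec a b N u) - fourierVec a b N u‖
      ≤ 8 * κ * (Real.sqrt r + meshSize a b N) := by
  have hpos := sub_pos.2 hab
  obtain ⟨Q, hQ, hI⟩ := h.exists_density
  have h1 := h.norm_fourierVec_sub_gridVec_le hab hN hκ
  set c := fourierVec a b N u
  set d := gridVec a b N u
  have h2 : ‖freeFlow a b r d - d‖ ≤ 4 * κ * Real.sqrt r := by
    refine le_of_sq_le_sq ?_ (by positivity)
    refine (sq_norm_freeFlow_sub_self_le hr d).trans ?_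
    have h3 := sineEnergy_gridVec_le hab hN hQ h.left_eq_zero h.right_eq_zero
    have h4 : (b - a) / 2 * sineEnergy a b d ≤ (b - a) / 2 * (5 * κ ^ 2) := by
      refine h3.trans ?_
      linarith
    have h5 := le_of_mul_le_mul_left h4 (by positivity)
    rw [mul_pow, Real.sq_sqrt hr]
    nlinarith [mul_nonneg hr (sq_nonneg κ)]
  have e : freeFlow a b r c - c
      = (freeFlow a b r (c - d) - (c - d)) + (freeFlow a b r d - d) := by
    rw [freeFlow_sub]; abel
  rw [e]
  refine (norm_add_le _ _).trans ?_
  have h6 := norm_freeFlow_sub_self_le_two (a := a) (b := b) r (c - d)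
  have h7 : 0 ≤ κ * Real.sqrt r := by positivity
  linarith

theorem IsH10Bounded.integral_sq_norm_le (hab : a < b) (hN : 1 ≤ N) (h : IsH10Bounded a b u κ) :
    ∫ x in a..b, ‖u x‖ ^ 2
      ≤ 7 * meshSize a b N ^ 2 * ((b - a) * κ ^ 2) + (b - a) / 2 * ‖fourierVec a b N u‖ ^ 2 := by
  have h1 := integral_sq_norm_sub_sineSynth_le hab h.continuousOn (0 : SineCoeffs N)
    (gridVec a b N u)
  have h2 := h.integral_sq_norm_sub_gridVec_le hab hN
  simp only [sineSynth, PiLp.zero_apply, zero_mul, Finset.sum_const_zero, sub_zero] at h1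
  exact h1.trans (add_le_add h2 le_rfl)

theorem norm_fourierVec_le_of_norm_le (hab : a < b) (hu : ContinuousOn u (Icc a b)) {B : ℝ}
    (hB : 0 ≤ B) (h : ∀ x ∈ Icc a b, ‖u x‖ ≤ B) : ‖fourierVec a b N u‖ ≤ 2 * B := by
  have hpos := sub_pos.2 hab
  refine le_of_sq_le_sq ?_ (by positivity)
  have h1 : ∫ x in a..b, ‖u x‖ ^ 2 ≤ ∫ x in a..b, B ^ 2 := by
    refine intervalIntegral.integral_mono_on hab.le ?_ (by simp) fun x hx => ?_
    · apply ContinuousOn.intervalIntegrable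
      rw [uIcc_of_le hab.le]
      exact hu.norm.pow 2
    · have := h x hx
      gcongr
  rw [intervalIntegral.integral_const, smul_eq_mul] at h1
  have h2 : (b - a) / 2 * ‖fourierVec a b N u‖ ^ 2 ≤ (b - a) / 2 * (2 * B ^ 2) :=
    (sq_norm_fourierVec_le hab hu).trans (h1.trans (le_of_eq (by ring)))
  have h3 := le_of_mul_le_mul_left h2 (by positivity)
  nlinarith [sq_nonneg B]

end H10Bounded

/-! ### The source term of the equation -/

section FieldTerm

variable {a b β σ κ Vm R : ℝ} {N : ℕ} {V : ℝ → ℝ} {u v : ℝ → ℂ}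

/-- The term `V u + f(|u|²) u` of the equation. -/
def fieldTerm (β σ : ℝ) (V : ℝ → ℝ) (u : ℝ → ℂ) (x : ℝ) : ℂ :=
  ((V x + nonlin β σ (‖u x‖ ^ 2) : ℝ) : ℂ) * u x

/-- `V` belongs to `H¹(a, b)`, is bounded by `Vm`, and the mean square of its derivative is at
most `κ²`. -/
structure IsPotentialBounded (a b : ℝ) (V : ℝ → ℝ) (Vm κ : ℝ) : Prop where
  continuousOn : ContinuousOn V (Icc a b)
  abs_le : ∀ x ∈ Icc a b, |V x| ≤ Vm
  exists_density : ∃ Q, HasEnergyDensity a b V Q ∧ ∫ x in a..b, Q x ≤ (b - a) * κ ^ 2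

theorem norm_field_sub_le (hσ : 0 < σ) (hσ' : σ ≤ 1 / 2) {p q : ℝ} {z w : ℂ} (hp : |p| ≤ Vm)
    (hz : ‖z‖ ≤ R) (hw : ‖w‖ ≤ R) :
    ‖((p + nonlin β σ (‖z‖ ^ 2) : ℝ) : ℂ) * z - ((q + nonlin β σ (‖w‖ ^ 2) : ℝ) : ℂ) * w‖
      ≤ (Vm + 2 * |β| * R ^ (2 * σ)) * ‖z - w‖ + R * ‖p - q‖ := by
  have e : ((p + nonlin β σ (‖z‖ ^ 2) : ℝ) : ℂ) * z - ((q + nonlin β σ (‖w‖ ^ 2) : ℝ) : ℂ) * w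
      = (p : ℂ) * (z - w) + ((p - q : ℝ) : ℂ) * w
        + ((nonlin β σ (‖z‖ ^ 2) : ℂ) * z - (nonlin β σ (‖w‖ ^ 2) : ℂ) * w) := by
    push_cast; ring
  rw [e]
  refine (norm_add₃_le).trans ?_
  rw [norm_mul, norm_mul, Complex.norm_real, Complex.norm_real, Real.norm_eq_abs p]
  have h1 := norm_nonlin_mul_sub_le (β := β) hσ hσ' hz hw
  have h2 := mul_le_mul_of_nonneg_right hp (norm_nonneg (z - w))
  have h3 := mul_le_mul_of_nonneg_left hw (norm_nonneg (p - q))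
  linarith

theorem continuousOn_fieldTerm (hσ : 0 < σ) (hV : ContinuousOn V (Icc a b))
    (hu : ContinuousOn u (Icc a b)) : ContinuousOn (fieldTerm β σ V u) (Icc a b) := by
  unfold fieldTerm nonlin
  refine ContinuousOn.mul ?_ hu
  refine Complex.continuous_ofReal.comp_continuousOn ?_
  exact hV.add (continuousOn_const.mul ((hu.norm.pow 2).rpow_const fun _ _ => Or.inr hσ.le))

/-- The nonlinearity maps bounded sets of `H¹₀` into bounded sets of `H¹₀`. -/
theorem IsH10Bounded.fieldTerm (hab : a < b) (hσ : 0 < σ) (hσ' : σ ≤ 1 / 2)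
    (hV : IsPotentialBounded a b V Vm κ) (hVm : 0 ≤ Vm) (hR : 0 ≤ R) (hu : IsH10Bounded a b u κ)
    (huR : ∀ x ∈ Icc a b, ‖u x‖ ≤ R) :
    IsH10Bounded a b (fieldTerm β σ V u)
      (2 * (Vm + 2 * |β| * R ^ (2 * σ) + R) * κ) := by
  have hpos := sub_pos.2 hab
  obtain ⟨Q, hQ, hI⟩ := hu.exists_density
  obtain ⟨P, hP, hJ⟩ := hV.exists_density
  refine ⟨continuousOn_fieldTerm hσ hV.continuousOn hu.continuousOn, ?_, ?_, _,
    hQ.of_norm_sub_le hP (Vm + 2 * |β| * R ^ (2 * σ)) R fun x hx y hy =>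
      norm_field_sub_le hσ hσ' (hV.abs_le y hy) (huR y hy) (huR x hx), ?_⟩
  · rw [NLS.fieldTerm, hu.left_eq_zero, mul_zero]
  · rw [NLS.fieldTerm, hu.right_eq_zero, mul_zero]
  · rw [hQ.integral_weighted_add hP]
    set Λ := Vm + 2 * |β| * R ^ (2 * σ)
    have hΛ : 0 ≤ Λ := by positivity
    calc _ ≤ 2 * Λ ^ 2 * ((b - a) * κ ^ 2) + 2 * R ^ 2 * ((b - a) * κ ^ 2) := by gcongr
      _ = (b - a) * ((2 * Λ ^ 2 + 2 * R ^ 2) * κ ^ 2) := by ring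
      _ ≤ (b - a) * ((2 * (Λ + R)) ^ 2 * κ ^ 2) := by
        gcongr
        nlinarith [mul_nonneg hΛ hR, sq_nonneg Λ, sq_nonneg R]
      _ = _ := by ring

theorem integral_sq_norm_fieldTerm_sub_le (hab : a < b) (hσ : 0 < σ) (hσ' : σ ≤ 1 / 2)
    (hV : IsPotentialBounded a b V Vm κ) (hu : ContinuousOn u (Icc a b))
    (hv : ContinuousOn v (Icc a b)) (huR : ∀ x ∈ Icc a b, ‖u x‖ ≤ R)
    (hvR : ∀ x ∈ Icc a b, ‖v x‖ ≤ R) :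
    ∫ x in a..b, ‖fieldTerm β σ V u x - fieldTerm β σ V v x‖ ^ 2
      ≤ (Vm + 2 * |β| * R ^ (2 * σ)) ^ 2 * ∫ x in a..b, ‖u x - v x‖ ^ 2 := by
  rw [← intervalIntegral.integral_const_mul]
  refine intervalIntegral.integral_mono_on hab.le ?_ ?_ fun x hx => ?_
  · apply ContinuousOn.intervalIntegrable
    rw [uIcc_of_le hab.le]
    exact ((continuousOn_fieldTerm hσ hV.continuousOn hu).sub
      (continuousOn_fieldTerm hσ hV.continuousOn hv)).norm.pow 2
  · apply ContinuousOn.intervalIntegrable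
    rw [uIcc_of_le hab.le]
    exact continuousOn_const.mul ((hu.sub hv).norm.pow 2)
  · have h := norm_field_sub_le (β := β) (q := V x) hσ hσ' (hV.abs_le x hx) (huR x hx) (hvR x hx)
    rw [sub_self, norm_zero, mul_zero, add_zero] at h
    rw [← mul_pow]
    gcongr
    exact h

end FieldTerm

/-! ### The evolution of the sine coefficients -/

section Evolution

variable {a b : ℝ}

theorem memH10_sin (hab : a < b) (l : ℕ) :
    MemH10 a b (fun x => (Real.sin (freq a b l * (x - a)) : ℂ)) := by
  have hc : Continuous fun x => (Real.sin (freq a b l * (x - a)) : ℂ) := by fun_prop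
  refine ⟨⟨hc.continuousOn, ?_, _, hasWeakDerivL2_of_hasDerivAt
    (u' := fun x => ((freq a b l * Real.cos (freq a b l * (x - a)) : ℝ) : ℂ))
    (fun x => (hasDerivAt_sin_freq l x).ofReal_comp) (by fun_prop)⟩, by simp, ?_⟩
  · rw [memLp_two_iff_integrable_sq_norm hc.aestronglyMeasurable]
    exact ((hc.norm.pow 2).integrableOn_Icc (a := a) (b := b)).mono_set Ioo_subset_Icc_self
  · have h0 := (sub_pos.2 hab).ne'
    have : freq a b l * (b - a) = l * Real.pi := by
      rw [freq]; field_simp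
    rw [this, Real.sin_nat_mul_pi, Complex.ofReal_zero]

/-- Integration by parts against an eigenfunction of the Dirichlet Laplacian. -/
theorem MemH10.integral_weakDeriv_mul_weakDeriv_sin (hab : a < b) {u : ℝ → ℂ}
    (hu : MemH10 a b u) (l : ℕ) :
    ∫ x in a..b, weakDeriv a b u x *
        weakDeriv a b (fun x => (Real.sin (freq a b l * (x - a)) : ℂ)) x
      = (freq a b l : ℂ) ^ 2 * ∫ x in a..b, u x * (Real.sin (freq a b l * (x - a)) : ℂ) := by
  have hd := hu.toMemH1.hasWeakDerivL2_weakDeriv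
  have hg := intervalIntegrable_of_memLp hd.1 hab.le
  have hprim : ∀ x ∈ Icc a b, ∫ t in a..x, weakDeriv a b u t = u x := fun x hx => by
    rw [← hd.sub_eq_integral hab hu.continuousOn hx, hu.left_eq_zero, sub_zero]
  have hae := (memH10_sin hab l).toMemH1.hasWeakDerivL2_weakDeriv.ae_eq hab
    (hasWeakDerivL2_of_hasDerivAt (a := a) (b := b)
      (u' := fun x => ((freq a b l * Real.cos (freq a b l * (x - a)) : ℝ) : ℂ))
      (fun x => (hasDerivAt_sin_freq l x).ofReal_comp) (by fun_prop))
  have h1 : ∫ x in a..b, weakDeriv a b u x *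
        weakDeriv a b (fun x => (Real.sin (freq a b l * (x - a)) : ℂ)) x
      = ∫ x in a..b, (freq a b l * Real.cos (freq a b l * (x - a))) • weakDeriv a b u x := by
    rw [intervalIntegral.integral_of_le hab.le, intervalIntegral.integral_of_le hab.le,
      integral_Ioc_eq_integral_Ioo, integral_Ioc_eq_integral_Ioo]
    refine setIntegral_congr_ae measurableSet_Ioo ?_
    filter_upwards [hae] with x hx hx'
    rw [hx hx', Complex.real_smul, mul_comm]
  have hder : ∀ x, HasDerivAt (fun x => freq a b l * Real.cos (freq a b l * (x - a)))
      (-(freq a b l ^ 2 * Real.sin (freq a b l * (x - a)))) x := fun x => by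
    have h2 : HasDerivAt (fun x => freq a b l * (x - a)) (freq a b l) x := by
      simpa using ((hasDerivAt_id x).sub_const a).const_mul (freq a b l)
    have h3 := h2.cos.const_mul (freq a b l)
    convert! h3 using 1
    ring
  rw [h1, integral_smul_eq_smul_integral_sub hder (by fun_prop) hg,
    hprim b (right_mem_Icc.2 hab.le), hu.right_eq_zero, smul_zero, zero_sub,
    ← intervalIntegral.integral_neg, ← intervalIntegral.integral_const_mul]
  refine intervalIntegral.integral_congr fun x hx => ?_
  rw [uIcc_of_le hab.le] at hx
  simp only [hprim x hx, Complex.real_smul]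
  push_cast
  ring

theorem SolvesNLS.hasDerivWithinAt_fourierVec {β σ T : ℝ} {V : ℝ → ℝ} {ψ : ℝ → ℝ → ℂ}
    (hab : a < b) (hψ : ∀ t ∈ Icc 0 T, MemH10 a b (ψ t)) (h : SolvesNLS a b β σ T V ψ) {N : ℕ}
    (l : Finset.Ico 1 N) {t : ℝ} (ht : t ∈ Icc 0 T) :
    HasDerivWithinAt (fun s => fourierVec a b N (ψ s) l)
      (-Complex.I * ((freq a b l : ℂ) ^ 2 * fourierVec a b N (ψ t) l
        + fourierVec a b N (fieldTerm β σ V (ψ t)) l)) (Icc 0 T) t := by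
  have h1 := (h _ (memH10_sin hab l) t ht).const_mul ((2 / (b - a) : ℝ) : ℂ)
  rw [(hψ t ht).integral_weakDeriv_mul_weakDeriv_sin hab] at h1
  refine h1.congr_deriv ?_
  simp only [fourierVec, fieldTerm]
  ring

variable {N : ℕ} {T : ℝ} {c g : ℝ → SineCoeffs N}

theorem hasDerivWithinAt_freeFlow
    (h : ∀ t ∈ Icc 0 T, ∀ l, HasDerivWithinAt (fun s => c s l)
      (-Complex.I * ((freq a b l : ℂ) ^ 2 * c t l + g t l)) (Icc 0 T) t)
    {t τ r : ℝ} (ht : 0 ≤ t) (htT : t + τ ≤ T) (hr : r ∈ Icc 0 τ) :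
    HasDerivWithinAt (fun r => freeFlow a b r (c (t + r)))
      (-Complex.I • freeFlow a b r (g (t + r))) (Icc 0 τ) r := by
  suffices hp : HasDerivWithinAt (fun r => fun l => freeFlow a b r (c (t + r)) l)
      (fun l => (-Complex.I • freeFlow a b r (g (t + r))) l) (Icc 0 τ) r from
    (PiLp.continuousLinearEquiv 2 ℝ
      (fun _ : Finset.Ico 1 N => ℂ)).symm.hasFDerivAt.comp_hasDerivWithinAt r hp
  rw [hasDerivWithinAt_pi]
  intro l
  have h1 : HasDerivWithinAt (fun r => t + r) 1 (Icc 0 τ) r :=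
    ((hasDerivAt_id r).const_add t).hasDerivWithinAt
  have h2 := (h (t + r) ⟨by linarith [hr.1], by linarith [hr.2]⟩ l).scomp r h1
    (fun s hs => ⟨by linarith [hs.1], by linarith [hs.2]⟩)
  have h3 : HasDerivWithinAt
      (fun r : ℝ => Complex.exp (Complex.I * ((r * freq a b l ^ 2 : ℝ) : ℂ)))
      (Complex.exp (Complex.I * ((r * freq a b l ^ 2 : ℝ) : ℂ)) *
        (Complex.I * ((1 * freq a b l ^ 2 : ℝ) : ℂ))) (Icc 0 τ) r :=
    ((((hasDerivAt_id r).mul_const (freq a b l ^ 2)).ofReal_comp.const_mul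
      Complex.I).cexp).hasDerivWithinAt
  refine (h3.mul h2).congr_deriv ?_
  simp only [PiLp.smul_apply, freeFlow_apply, Function.comp, one_smul, smul_eq_mul, one_mul]
  push_cast
  ring

/-- Duhamel's formula with frozen source term `y`, as a consequence of the mean value
inequality. -/
theorem norm_freeFlow_sub_add_le
    (h : ∀ t ∈ Icc 0 T, ∀ l, HasDerivWithinAt (fun s => c s l)
      (-Complex.I * ((freq a b l : ℂ) ^ 2 * c t l + g t l)) (Icc 0 T) t)
    {t τ B : ℝ} (ht : 0 ≤ t) (hτ : 0 ≤ τ) (htT : t + τ ≤ T) (y : SineCoeffs N)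
    (hB : ∀ r ∈ Icc 0 τ, ‖freeFlow a b r (g (t + r)) - y‖ ≤ B) :
    ‖freeFlow a b τ (c (t + τ)) - c t + ((τ : ℂ) * Complex.I) • y‖ ≤ τ * B := by
  have hd : ∀ r ∈ Icc 0 τ, HasDerivWithinAt
      (fun r : ℝ => freeFlow a b r (c (t + r)) + ((r : ℂ) * Complex.I) • y)
      (-Complex.I • (freeFlow a b r (g (t + r)) - y)) (Icc 0 τ) r := fun r hr => by
    have h1 : HasDerivWithinAt (fun r : ℝ => ((r : ℂ) * Complex.I) • y) (Complex.I • y)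
        (Icc 0 τ) r := by
      have := (((hasDerivAt_id r).ofReal_comp.mul_const Complex.I).smul_const y).hasDerivWithinAt
        (s := Icc 0 τ)
      simpa using this
    refine ((hasDerivWithinAt_freeFlow h ht htT hr).add h1).congr_deriv ?_
    rw [smul_sub, neg_smul, neg_smul, sub_neg_eq_add]
  have := (convex_Icc 0 τ).norm_image_sub_le_of_norm_hasDerivWithin_le hd (C := B)
    (fun r hr => by rw [norm_smul, norm_neg, Complex.norm_I, one_mul]; exact hB r hr)
    (left_mem_Icc.2 hτ) (right_mem_Icc.2 hτ)
  rw [sub_zero, Real.norm_of_nonneg hτ, mul_comm B] at this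
  refine le_trans (le_of_eq ?_) this
  congr 1
  simp only [add_zero, freeFlow_zero, Complex.ofReal_zero, zero_mul, zero_smul]
  abel

end Evolution

/-! ### Local error -/

section LocalError

variable {a b β σ κ K Vm R T : ℝ} {N : ℕ} {V : ℝ → ℝ} {u : ℝ → ℂ} {ψ : ℝ → ℝ → ℂ}

/-- The interaction picture of the source term varies by `O(√τ + h)` over a time step. -/
theorem norm_freeFlow_source_sub_le (hab : a < b) (hσ : 0 < σ) (hσ' : σ ≤ 1 / 2) (hN : 1 ≤ N)
    (hκ : 0 ≤ κ) (hK : 0 ≤ K) (hVm : 0 ≤ Vm) (hR : 0 ≤ R)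
    (hV : IsPotentialBounded a b V Vm κ)
    (hψ : ∀ t ∈ Icc 0 T, IsH10Bounded a b (ψ t) κ)
    (hψR : ∀ t ∈ Icc 0 T, ∀ x ∈ Icc a b, ‖ψ t x‖ ≤ R)
    (hG : ∀ t ∈ Icc 0 T, IsH10Bounded a b (fieldTerm β σ V (ψ t)) K)
    (hode : ∀ t ∈ Icc 0 T, ∀ l : Finset.Ico 1 N,
      HasDerivWithinAt (fun s => fourierVec a b N (ψ s) l)
      (-Complex.I * ((freq a b l : ℂ) ^ 2 * fourierVec a b N (ψ t) l
        + fourierVec a b N (fieldTerm β σ V (ψ t)) l)) (Icc 0 T) t)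
    {t τ r : ℝ} (ht : 0 ≤ t) (hτ1 : τ ≤ 1) (htT : t + τ ≤ T) (hr : r ∈ Icc 0 τ) :
    ‖freeFlow a b r (fourierVec a b N (fieldTerm β σ V (ψ (t + r))))
        - fourierVec a b N (fieldTerm β σ V (ψ t))‖
      ≤ ((Vm + 2 * |β| * R ^ (2 * σ)) * (16 * κ + 2 * (b - a) * K) + 8 * K) *
        (Real.sqrt τ + meshSize a b N) := by
  have hpos := sub_pos.2 hab
  have hh := meshSize_nonneg hab.le N
  have hτ : 0 ≤ τ := hr.1.trans hr.2
  have hrτ : Real.sqrt r ≤ Real.sqrt τ := Real.sqrt_le_sqrt hr.2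
  have hτs : τ ≤ Real.sqrt τ := by
    apply Real.le_sqrt_of_sq_le
    nlinarith
  have hδ0 : 0 ≤ Real.sqrt τ := Real.sqrt_nonneg _
  have mem : ∀ s ∈ Icc 0 τ, t + s ∈ Icc 0 T := fun s hs =>
    ⟨by linarith [hs.1], by linarith [hs.2]⟩
  have mt : t ∈ Icc 0 T := ⟨ht, by linarith⟩
  set δ := Real.sqrt τ + meshSize a b N with hδ
  set Λ := Vm + 2 * |β| * R ^ (2 * σ) with hΛ
  have hΛ0 : 0 ≤ Λ := by positivity
  have hδ' : 0 ≤ δ := by positivity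
  have hrδ : Real.sqrt r + meshSize a b N ≤ δ := add_le_add hrτ le_rfl
  have hgm : ∀ s ∈ Icc 0 T, ‖fourierVec a b N (fieldTerm β σ V (ψ s))‖ ≤ 2 * ((b - a) * K) :=
    fun s hs => norm_fourierVec_le_of_norm_le hab (hG s hs).continuousOn (by positivity)
      fun x hx => (hG s hs).norm_le hab hK hx
  -- the coefficients of the solution
  have hc : ‖fourierVec a b N (ψ (t + r)) - fourierVec a b N (ψ t)‖
      ≤ (2 * ((b - a) * K) + 8 * κ) * δ := by
    have h1 := norm_freeFlow_sub_add_le (c := fun s => fourierVec a b N (ψ s))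
      (g := fun s => fourierVec a b N (fieldTerm β σ V (ψ s))) hode ht hr.1
      (by linarith [hr.2] : t + r ≤ T) 0 (B := 2 * ((b - a) * K)) fun s hs => by
        rw [sub_zero, norm_freeFlow]
        exact hgm _ (mem s ⟨hs.1, hs.2.trans hr.2⟩)
    rw [smul_zero, add_zero] at h1
    have h2 := (hψ t mt).norm_freeFlow_fourierVec_sub_le hab hN hκ hr.1
    rw [← norm_freeFlow (a := a) (b := b) r, freeFlow_sub]
    refine (norm_sub_le_norm_sub_add_norm_sub _ (fourierVec a b N (ψ t)) _).trans ?_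
    rw [norm_sub_rev (fourierVec a b N (ψ t))]
    have h3 : r * (2 * ((b - a) * K)) ≤ δ * (2 * ((b - a) * K)) := by
      gcongr
      linarith [hr.2]
    have h4 : 8 * κ * (Real.sqrt r + meshSize a b N) ≤ 8 * κ * δ := by gcongr
    linarith
  -- the solution itself, in `L²`
  have hu : ∫ x in a..b, ‖ψ (t + r) x - ψ t x‖ ^ 2
      ≤ (b - a) / 2 * ((16 * κ + 2 * (b - a) * K) * δ) ^ 2 := by
    have h1 := ((hψ _ (mem r hr)).sub (hψ t mt)).integral_sq_norm_le hab hN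
    rw [fourierVec_sub hab.le (hψ _ (mem r hr)).continuousOn (hψ t mt).continuousOn] at h1
    refine h1.trans ?_
    have h2 : meshSize a b N ≤ δ := by linarith
    calc _ ≤ 7 * δ ^ 2 * ((b - a) * (2 * κ) ^ 2)
          + (b - a) / 2 * ((2 * ((b - a) * K) + 8 * κ) * δ) ^ 2 := by gcongr
      _ = (b - a) / 2 * ((56 * κ ^ 2 + (2 * ((b - a) * K) + 8 * κ) ^ 2) * δ ^ 2) := by ring
      _ ≤ (b - a) / 2 * ((16 * κ + 2 * (b - a) * K) ^ 2 * δ ^ 2) := by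
        gcongr
        nlinarith [mul_nonneg hκ (mul_nonneg hpos.le hK), sq_nonneg κ]
      _ = _ := by ring
  -- the source term
  have hg : ‖fourierVec a b N (fieldTerm β σ V (ψ (t + r)))
      - fourierVec a b N (fieldTerm β σ V (ψ t))‖ ≤ Λ * ((16 * κ + 2 * (b - a) * K) * δ) := by
    refine le_of_sq_le_sq ?_ (by positivity)
    rw [← fourierVec_sub hab.le (hG _ (mem r hr)).continuousOn (hG t mt).continuousOn]
    have h1 := (sq_norm_fourierVec_le (N := N) hab
      ((hG _ (mem r hr)).continuousOn.sub (hG t mt).continuousOn)).trans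
      (integral_sq_norm_fieldTerm_sub_le hab hσ hσ' hV (hψ _ (mem r hr)).continuousOn
        (hψ t mt).continuousOn (hψR _ (mem r hr)) (hψR t mt))
    have h2 : (b - a) / 2 * ‖fourierVec a b N
        (fun x => fieldTerm β σ V (ψ (t + r)) x - fieldTerm β σ V (ψ t) x)‖ ^ 2
        ≤ (b - a) / 2 * (Λ * ((16 * κ + 2 * (b - a) * K) * δ)) ^ 2 := by
      calc _ ≤ Λ ^ 2 * ((b - a) / 2 * ((16 * κ + 2 * (b - a) * K) * δ) ^ 2) :=
            h1.trans (by gcongr)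
        _ = _ := by ring
    exact le_of_mul_le_mul_left h2 (by positivity)
  have h3 := (hG t mt).norm_freeFlow_fourierVec_sub_le hab hN hK hr.1
  refine (norm_sub_le_norm_sub_add_norm_sub _
    (freeFlow a b r (fourierVec a b N (fieldTerm β σ V (ψ t)))) _).trans ?_
  rw [← freeFlow_sub, norm_freeFlow]
  have h4 : 8 * K * (Real.sqrt r + meshSize a b N) ≤ 8 * K * δ := by gcongr
  linarith

/-- The truncated sine series of an `H¹₀` function is bounded on the grid. By the inverse
inequality between the maximum norm and the discrete `L²` norm, the first order convergence of the
truncated series more than suffices. -/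
theorem IsH10Bounded.norm_sineSynth_gridPoint_le (hab : a < b) (hN : 1 ≤ N) (hκ : 0 ≤ κ)
    (hh : meshSize a b N < 1) (hu : IsH10Bounded a b u κ) {j : ℕ} (hj : j ∈ Finset.Ico 1 N) :
    ‖sineSynth a b (fourierVec a b N u) (gridPoint a b N j)‖
      ≤ κ * ((b - a) + 3 * Real.sqrt (b - a)) := by
  have hpos := sub_pos.2 hab
  have hN0 : 0 < (N : ℝ) := by positivity
  have h0 := meshSize_nonneg hab.le N
  have hjN := Finset.mem_Ico.1 hj
  have h1 := hu.norm_fourierVec_sub_gridVec_le hab hN hκ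
  have h2 : 2 / (N : ℝ) * ‖sineSynth a b (fourierVec a b N u) (gridPoint a b N j)
      - u (gridPoint a b N j)‖ ^ 2 ≤ (4 * κ * meshSize a b N) ^ 2 := by
    have h3 : ‖fourierVec a b N u - gridVec a b N u‖ ^ 2 ≤ (4 * κ * meshSize a b N) ^ 2 := by
      gcongr
    rw [gridVec, ← sineVec_sineSynth hab (fourierVec a b N u), ← sineVec_sub,
      sq_norm_sineVec] at h3
    refine le_trans ?_ h3
    gcongr
    exact Finset.single_le_sum (f := fun j => ‖sineSynth a b (fourierVec a b N u)
      (gridPoint a b N j) - u (gridPoint a b N j)‖ ^ 2) (fun _ _ => by positivity) hj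
  have h4 : ‖sineSynth a b (fourierVec a b N u) (gridPoint a b N j) - u (gridPoint a b N j)‖
      ≤ κ * (3 * Real.sqrt (b - a)) := by
    refine le_of_sq_le_sq ?_ (by positivity)
    have hm : meshSize a b N * N = b - a := by rw [meshSize]; field_simp
    calc _ = N / 2 * (2 / (N : ℝ) * ‖sineSynth a b (fourierVec a b N u) (gridPoint a b N j)
          - u (gridPoint a b N j)‖ ^ 2) := by field_simp
      _ ≤ N / 2 * (4 * κ * meshSize a b N) ^ 2 := by gcongr
      _ = 8 * κ ^ 2 * (meshSize a b N * N) * meshSize a b N := by ring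
      _ ≤ 8 * κ ^ 2 * (b - a) * 1 := by
        rw [hm]
        gcongr
      _ ≤ 9 * κ ^ 2 * (b - a) := by nlinarith [mul_nonneg (sq_nonneg κ) hpos.le]
      _ = (κ * (3 * Real.sqrt (b - a))) ^ 2 := by
        rw [mul_pow, mul_pow, Real.sq_sqrt hpos.le]
        ring
  have h5 := hu.norm_le hab hκ (gridPoint_mem_Icc hab.le hN hjN.2.le)
  have h6 := norm_add_le (u (gridPoint a b N j))
    (sineSynth a b (fourierVec a b N u) (gridPoint a b N j) - u (gridPoint a b N j))
  rw [add_sub_cancel] at h6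
  linarith

/-- The pointwise substep, applied to the truncated sine series of an `H¹₀` function, agrees with
an Euler step for the source term up to `O(τ (τ + h))`. -/
theorem norm_sineVec_phaseFlow_sub_add_le (hab : a < b) (hσ : 0 < σ) (hσ' : σ ≤ 1 / 2)
    (hN : 1 ≤ N) (hκ : 0 ≤ κ) (hK : 0 ≤ K) (hVm : 0 ≤ Vm) (hR : 0 ≤ R)
    (hV : IsPotentialBounded a b V Vm κ) (hu : IsH10Bounded a b u κ)
    (hG : IsH10Bounded a b (fieldTerm β σ V u) K) (huR : ∀ x ∈ Icc a b, ‖u x‖ ≤ R)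
    (hwR : ∀ j ∈ Finset.Ico 1 N, ‖sineSynth a b (fourierVec a b N u) (gridPoint a b N j)‖ ≤ R)
    {τ : ℝ} (hτ : 0 ≤ τ) :
    ‖sineVec N (fun j => phaseFlow β σ τ (V (gridPoint a b N j))
        (sineSynth a b (fourierVec a b N u) (gridPoint a b N j)))
        - fourierVec a b N u + ((τ : ℂ) * Complex.I) • fourierVec a b N (fieldTerm β σ V u)‖
      ≤ τ * ((4 * κ * (Vm + 2 * |β| * R ^ (2 * σ)) + 4 * K) * meshSize a b N
        + 4 * (Vm + |β| * R ^ (2 * σ)) ^ 2 * R * τ) := by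
  set c := fourierVec a b N u with hc
  set g := fourierVec a b N (fieldTerm β σ V u) with hg
  set x := gridPoint a b N with hx
  set w : ℕ → ℂ := fun j => sineSynth a b c (x j) with hw
  have hmem : ∀ j ∈ Finset.Ico 1 N, x j ∈ Icc a b := fun j hj =>
    gridPoint_mem_Icc hab.le hN (Finset.mem_Ico.1 hj).2.le
  have hcw : sineVec N w = c := sineVec_sineSynth hab c
  have e : sineVec N (fun j => phaseFlow β σ τ (V (x j)) (w j)) - c
        + ((τ : ℂ) * Complex.I) • g
      = sineVec N (fun j => (phaseFlow β σ τ (V (x j)) (w j) - w j)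
          - (phaseFlow β σ τ (V (x j)) (u (x j)) - u (x j)))
        + sineVec N (fun j => (phaseFlow β σ τ (V (x j)) (u (x j)) - u (x j))
          - -((τ : ℂ) * Complex.I) * fieldTerm β σ V u (x j))
        + ((τ : ℂ) * Complex.I) • (g - gridVec a b N (fieldTerm β σ V u)) := by
    have hgrid : gridVec a b N (fieldTerm β σ V u)
        = sineVec N fun j => fieldTerm β σ V u (x j) := rfl
    rw [hgrid]
    simp only [sineVec_sub, sineVec_smul, hcw, smul_sub, neg_smul]
    abel
  have h1 : ‖sineVec N (fun j => (phaseFlow β σ τ (V (x j)) (w j) - w j)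
      - (phaseFlow β σ τ (V (x j)) (u (x j)) - u (x j)))‖
      ≤ τ * (Vm + 2 * |β| * R ^ (2 * σ)) * (4 * κ * meshSize a b N) := by
    refine (norm_sineVec_le_mul (v := fun j => w j - u (x j))
      (A := τ * (Vm + 2 * |β| * R ^ (2 * σ))) (by positivity) fun j hj =>
      norm_phaseFlow_sub_self_sub_le hσ hσ' hτ (hV.abs_le _ (hmem j hj)) (hwR j hj)
        (huR _ (hmem j hj))).trans ?_
    rw [sineVec_sub, hcw]
    exact mul_le_mul_of_nonneg_left (hu.norm_fourierVec_sub_gridVec_le hab hN hκ) (by positivity)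
  have h2 : ‖sineVec N (fun j => (phaseFlow β σ τ (V (x j)) (u (x j)) - u (x j))
      - -((τ : ℂ) * Complex.I) * fieldTerm β σ V u (x j))‖
      ≤ 2 * (2 * τ ^ 2 * (Vm + |β| * R ^ (2 * σ)) ^ 2 * R) := by
    refine norm_sineVec_le (by positivity) fun j hj => ?_
    rw [neg_mul, sub_neg_eq_add]
    exact norm_phaseFlow_sub_self_add_le hσ hτ (hV.abs_le _ (hmem j hj)) (huR _ (hmem j hj))
  have h3 : ‖((τ : ℂ) * Complex.I) • (g - gridVec a b N (fieldTerm β σ V u))‖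
      ≤ τ * (4 * K * meshSize a b N) := by
    rw [norm_smul, norm_mul, Complex.norm_I, mul_one, Complex.norm_real, Real.norm_of_nonneg hτ]
    exact mul_le_mul_of_nonneg_left (hG.norm_fourierVec_sub_gridVec_le hab hN hK) hτ
  rw [e]
  refine norm_add₃_le.trans ?_
  linarith

end LocalError

/-! ### Global error -/

section Convergence

/-- The discrete Grönwall inequality in the form needed for one-step methods. -/
theorem le_exp_mul_of_le_one_add_mul {e : ℕ → ℝ} {Λ τ B : ℝ} {n : ℕ} (hΛ : 0 ≤ Λ) (hτ : 0 ≤ τ)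
    (hB : 0 ≤ B) (he0 : 0 ≤ e 0)
    (h : ∀ k < n, e (k + 1) ≤ (1 + τ * Λ) * e k + τ * B) :
    ∀ k ≤ n, e k ≤ Real.exp (Λ * (k * τ)) * (e 0 + k * τ * B) := by
  intro k
  induction k with
  | zero => intro _; simp
  | succ k ih =>
    intro hk
    have h1 := ih (by omega)
    have h2 : 1 + τ * Λ ≤ Real.exp (Λ * τ) := by
      linarith [Real.add_one_le_exp (Λ * τ)]
    have h3 : (1 : ℝ) ≤ Real.exp (Λ * ((k + 1 : ℕ) * τ)) := Real.one_le_exp (by positivity)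
    have h4 : Real.exp (Λ * ((k + 1 : ℕ) * τ)) = Real.exp (Λ * τ) * Real.exp (Λ * (k * τ)) := by
      rw [← Real.exp_add]
      congr 1
      push_cast; ring
    calc e (k + 1) ≤ (1 + τ * Λ) * e k + τ * B := h k (by omega)
      _ ≤ (1 + τ * Λ) * (Real.exp (Λ * (k * τ)) * (e 0 + k * τ * B)) + τ * B := by gcongr
      _ ≤ Real.exp (Λ * τ) * (Real.exp (Λ * (k * τ)) * (e 0 + k * τ * B)) + 1 * (τ * B) := by
        rw [one_mul]
        gcongr
      _ ≤ Real.exp (Λ * τ) * (Real.exp (Λ * (k * τ)) * (e 0 + k * τ * B))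
          + Real.exp (Λ * ((k + 1 : ℕ) * τ)) * (τ * B) := by gcongr
      _ = _ := by
        rw [h4]
        push_cast; ring

variable {a b β σ κ K Vm R T : ℝ} {N : ℕ} {V : ℝ → ℝ} {ψ : ℝ → ℝ → ℂ}

/-- Error propagation over one step of the scheme, in sine coefficients. -/
theorem norm_fourierVec_sub_tssp_succ_le (hab : a < b) (hσ : 0 < σ) (hσ' : σ ≤ 1 / 2)
    (hN : 1 ≤ N) (hκ : 0 ≤ κ) (hK : 0 ≤ K) (hVm : 0 ≤ Vm)
    (hR : R = κ * ((b - a) + 3 * Real.sqrt (b - a))) (hh : meshSize a b N < 1)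
    (hV : IsPotentialBounded a b V Vm κ)
    (hψ : ∀ t ∈ Icc 0 T, IsH10Bounded a b (ψ t) κ)
    (hG : ∀ t ∈ Icc 0 T, IsH10Bounded a b (fieldTerm β σ V (ψ t)) K)
    (hode : ∀ t ∈ Icc 0 T, ∀ l : Finset.Ico 1 N,
      HasDerivWithinAt (fun s => fourierVec a b N (ψ s) l)
      (-Complex.I * ((freq a b l : ℂ) ^ 2 * fourierVec a b N (ψ t) l
        + fourierVec a b N (fieldTerm β σ V (ψ t)) l)) (Icc 0 T) t)
    {t τ : ℝ} (ht : 0 ≤ t) (hτ : 0 ≤ τ) (hτ1 : τ ≤ 1) (htT : t + τ ≤ T) (w : ℕ → ℂ) :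
    ‖fourierVec a b N (ψ (t + τ))
        - sineVec N (kineticStep a b τ N (potentialStep a b β σ V τ N w))‖
      ≤ (1 + τ * (|β| * R ^ (2 * σ))) * ‖fourierVec a b N (ψ t) - sineVec N w‖
        + τ * ((((Vm + 2 * |β| * R ^ (2 * σ)) * (16 * κ + 2 * (b - a) * K) + 8 * K)
          + (4 * κ * (Vm + 2 * |β| * R ^ (2 * σ)) + 4 * K)
          + 4 * (Vm + |β| * R ^ (2 * σ)) ^ 2 * R) * (Real.sqrt τ + meshSize a b N)) := by
  have hpos := sub_pos.2 hab
  have hR0 : 0 ≤ R := by rw [hR]; positivity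
  have mt : t ∈ Icc 0 T := ⟨ht, by linarith⟩
  have h0 := meshSize_nonneg hab.le N
  have hτs : τ ≤ Real.sqrt τ := by
    apply Real.le_sqrt_of_sq_le
    nlinarith
  have hψR : ∀ t ∈ Icc 0 T, ∀ x ∈ Icc a b, ‖ψ t x‖ ≤ R := fun t ht x hx => by
    refine ((hψ t ht).norm_le hab hκ hx).trans ?_
    rw [hR, mul_comm]
    gcongr
    linarith [Real.sqrt_nonneg (b - a)]
  have hwR : ∀ j ∈ Finset.Ico 1 N,
      ‖sineSynth a b (fourierVec a b N (ψ t)) (gridPoint a b N j)‖ ≤ R := fun j hj => by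
    rw [hR]
    exact (hψ t mt).norm_sineSynth_gridPoint_le hab hN hκ hh hj
  set x := gridPoint a b N with hx
  set c := fourierVec a b N (ψ t) with hc
  set v : ℕ → ℂ := fun j => sineSynth a b c (x j) with hv
  set y := ((τ : ℂ) * Complex.I) • fourierVec a b N (fieldTerm β σ V (ψ t)) with hy
  -- temporal consistency
  have h1 := norm_freeFlow_sub_add_le (c := fun s => fourierVec a b N (ψ s))
    (g := fun s => fourierVec a b N (fieldTerm β σ V (ψ s))) hode ht hτ htT
    (fourierVec a b N (fieldTerm β σ V (ψ t))) fun r hr =>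
      norm_freeFlow_source_sub_le hab hσ hσ' hN hκ hK hVm hR0 hV hψ hψR hG hode ht hτ1 htT hr
  -- spatial consistency
  have h2 := norm_sineVec_phaseFlow_sub_add_le hab hσ hσ' hN hκ hK hVm hR0 hV (hψ t mt)
    (hG t mt) (hψR t mt) hwR hτ
  -- stability
  have h3 : ‖sineVec N (fun j => phaseFlow β σ τ (V (x j)) (v j)
        - phaseFlow β σ τ (V (x j)) (w j))‖
      ≤ (1 + τ * (|β| * R ^ (2 * σ))) * ‖c - sineVec N w‖ := by
    have h4 := norm_sineVec_le_mul (N := N) (v := fun j => v j - w j)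
      (A := 1 + τ * (|β| * R ^ (2 * σ))) (by positivity)
      (w := fun j => phaseFlow β σ τ (V (x j)) (v j) - phaseFlow β σ τ (V (x j)) (w j))
      fun j hj => by
        rw [norm_sub_rev, norm_sub_rev (v j)]
        exact norm_phaseFlow_sub_le hσ hσ' hτ (hwR j hj)
    rwa [sineVec_sub (N := N) v, sineVec_sineSynth hab c] at h4
  have hpot : potentialStep a b β σ V τ N w = fun j => phaseFlow β σ τ (V (x j)) (w j) := rfl
  rw [sineVec_kineticStep hab, hpot, ← freeFlow_neg_freeFlow (a := a) (b := b) τ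
    (fourierVec a b N (ψ (t + τ))), ← freeFlow_sub, norm_freeFlow]
  have e : freeFlow a b τ (fourierVec a b N (ψ (t + τ)))
        - sineVec N (fun j => phaseFlow β σ τ (V (x j)) (w j))
      = (freeFlow a b τ (fourierVec a b N (ψ (t + τ))) - c + y)
        - (sineVec N (fun j => phaseFlow β σ τ (V (x j)) (v j)) - c + y)
        + sineVec N (fun j => phaseFlow β σ τ (V (x j)) (v j)
          - phaseFlow β σ τ (V (x j)) (w j)) := by
    rw [sineVec_sub]
    abel
  rw [e]
  refine (norm_add_le _ _).trans ?_
  refine (add_le_add ((norm_sub_le _ _).trans (add_le_add h1 h2)) h3).trans ?_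
  have h5 : (4 * κ * (Vm + 2 * |β| * R ^ (2 * σ)) + 4 * K) * meshSize a b N
        + 4 * (Vm + |β| * R ^ (2 * σ)) ^ 2 * R * τ
      ≤ (4 * κ * (Vm + 2 * |β| * R ^ (2 * σ)) + 4 * K) * (Real.sqrt τ + meshSize a b N)
        + 4 * (Vm + |β| * R ^ (2 * σ)) ^ 2 * R * (Real.sqrt τ + meshSize a b N) := by
    have := Real.sqrt_nonneg τ
    gcongr
    · linarith
    · linarith
  have h6 := mul_le_mul_of_nonneg_left h5 hτ
  linarith

/-- The global error of the scheme, for data satisfying quantitative bounds in `H¹`. -/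
theorem l2Norm_sub_tssp_le (hab : a < b) (hσ : 0 < σ) (hσ' : σ ≤ 1 / 2)
    (hN : 1 ≤ N) (hκ : 0 ≤ κ) (hK : 0 ≤ K) (hVm : 0 ≤ Vm) (hT : 0 ≤ T)
    (hR : R = κ * ((b - a) + 3 * Real.sqrt (b - a))) (hh : meshSize a b N < 1)
    (hV : IsPotentialBounded a b V Vm κ)
    (hψ : ∀ t ∈ Icc 0 T, IsH10Bounded a b (ψ t) κ)
    (hG : ∀ t ∈ Icc 0 T, IsH10Bounded a b (fieldTerm β σ V (ψ t)) K)
    (hode : ∀ t ∈ Icc 0 T, ∀ l : Finset.Ico 1 N,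
      HasDerivWithinAt (fun s => fourierVec a b N (ψ s) l)
      (-Complex.I * ((freq a b l : ℂ) ^ 2 * fourierVec a b N (ψ t) l
        + fourierVec a b N (fieldTerm β σ V (ψ t)) l)) (Icc 0 T) t)
    {A E τ : ℝ}
    (hA : A = ((Vm + 2 * |β| * R ^ (2 * σ)) * (16 * κ + 2 * (b - a) * K) + 8 * K)
          + (4 * κ * (Vm + 2 * |β| * R ^ (2 * σ)) + 4 * K)
          + 4 * (Vm + |β| * R ^ (2 * σ)) ^ 2 * R)
    (hE : E = Real.exp (|β| * R ^ (2 * σ) * T) * (4 * κ + T * A))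
    (hτ : 0 ≤ τ) (hτ1 : τ ≤ 1) {k : ℕ} (hkT : k * τ ≤ T) :
    l2Norm a b (fun x => ψ (k * τ) x - sineInterp a b N (tssp a b β σ V (ψ 0) τ N k) x)
      ≤ Real.sqrt ((b - a) * (7 * κ ^ 2 + E ^ 2)) * (Real.sqrt τ + meshSize a b N) := by
  have hpos := sub_pos.2 hab
  have h0 := meshSize_nonneg hab.le N
  have hR0 : 0 ≤ R := by rw [hR]; positivity
  have hA0 : 0 ≤ A := by rw [hA]; positivity
  have hE0 : 0 ≤ E := by rw [hE]; positivity
  have hΛ0 : 0 ≤ |β| * R ^ (2 * σ) := by positivity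
  set δ := Real.sqrt τ + meshSize a b N with hδ
  have hδ0 : 0 ≤ δ := by positivity
  have hhδ : meshSize a b N ≤ δ := le_add_of_nonneg_left (Real.sqrt_nonneg _)
  let e : ℕ → ℝ := fun k => ‖fourierVec a b N (ψ (k * τ))
    - sineVec N (tssp a b β σ V (ψ 0) τ N k)‖
  have hnn : ∀ k, 0 ≤ e k := fun k => norm_nonneg _
  have he0 : e 0 ≤ 4 * κ * δ := by
    have h1 := (hψ 0 ⟨le_rfl, hT⟩).norm_fourierVec_sub_gridVec_le hab hN hκ
    have h2 : e 0 = ‖fourierVec a b N (ψ 0) - gridVec a b N (ψ 0)‖ := by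
      simp only [e, Nat.cast_zero, zero_mul]
      rfl
    rw [h2]
    exact h1.trans (by gcongr)
  have hstep : ∀ i < k, e (i + 1) ≤ (1 + τ * (|β| * R ^ (2 * σ))) * e i + τ * (A * δ) :=
    fun i hi => by
      have hi' : ((i + 1 : ℕ) : ℝ) ≤ k := by exact_mod_cast hi
      have h3 : ((i + 1 : ℕ) : ℝ) * τ = i * τ + τ := by push_cast; ring
      have h1 : (i : ℝ) * τ + τ ≤ T :=
        h3.ge.trans ((mul_le_mul_of_nonneg_right hi' hτ).trans hkT)
      have h2 := norm_fourierVec_sub_tssp_succ_le hab hσ hσ' hN hκ hK hVm hR hh hV hψ hG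
        hode (t := i * τ) (by positivity) hτ hτ1 h1 (tssp a b β σ V (ψ 0) τ N i)
      rw [← h3, ← hA] at h2
      exact h2
  have hek : e k ≤ E * δ := by
    refine (le_exp_mul_of_le_one_add_mul (e := e) hΛ0 hτ (mul_nonneg hA0 hδ0) (hnn 0) hstep k
      le_rfl).trans ?_
    have h1 := hnn 0
    calc _ ≤ Real.exp (|β| * R ^ (2 * σ) * T) * (4 * κ * δ + T * (A * δ)) := by gcongr
      _ = E * δ := by rw [hE]; ring
  have hψk := hψ (k * τ) ⟨by positivity, hkT⟩
  refine le_of_sq_le_sq ?_ (by positivity)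
  rw [l2Norm_sq hab.le, mul_pow, Real.sq_sqrt (by positivity)]
  simp only [sineInterp_eq]
  have h1 := integral_sq_norm_sub_sineSynth_le hab hψk.continuousOn
    (sineVec N (tssp a b β σ V (ψ 0) τ N k)) (gridVec a b N (ψ (k * τ)))
  have h2 := hψk.integral_sq_norm_sub_gridVec_le hab hN
  have h3 : e k ^ 2 ≤ (E * δ) ^ 2 := by
    have := hnn k
    gcongr
  calc _ ≤ 7 * meshSize a b N ^ 2 * ((b - a) * κ ^ 2) + (b - a) / 2 * e k ^ 2 :=
        h1.trans (add_le_add h2 le_rfl)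
    _ ≤ 7 * δ ^ 2 * ((b - a) * κ ^ 2) + (b - a) / 2 * (E * δ) ^ 2 := by gcongr
    _ ≤ 7 * δ ^ 2 * ((b - a) * κ ^ 2) + (b - a) * (E * δ) ^ 2 := by
      gcongr
      linarith
    _ = _ := by ring

end Convergence

end NLS

end

theorem corollary2p5 (a b : ℝ) (hab : a < b) (β σ : ℝ) (hσ_pos : 0 < σ) (hσ_le : σ ≤ 1 / 2)
    (T : ℝ) (hT : 0 < T) (M : ℝ) :
    ∃ C : ℝ, 0 < C ∧
      ∀ (V : ℝ → ℝ) (ψ : ℝ → ℝ → ℂ),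
        NLS.MemH1 a b V → NLS.h1Norm a b V ≤ M →
        NLS.ContinuousIntoH10 a b T ψ → (∀ t ∈ Set.Icc 0 T, NLS.h1Norm a b (ψ t) ≤ M) →
        NLS.SolvesNLS a b β σ T V ψ →
        ∀ (τ : ℝ) (N : ℕ), 0 < τ → τ < 1 → 1 ≤ N → NLS.meshSize a b N < 1 →
          ∀ k : ℕ, (k : ℝ) ≤ T / τ →
            NLS.l2Norm a b (fun x => ψ (k * τ) x -
                NLS.sineInterp a b N (NLS.tssp a b β σ V (ψ 0) τ N k) x)
              ≤ C * (τ ^ (1 / 2 : ℝ) + NLS.meshSize a b N) := by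
  have hpos := sub_pos.2 hab
  -- `κ` is chosen such that `(b - a) κ² = M²`
  set κ := Real.sqrt (M ^ 2 / (b - a)) with hκ
  have hκ0 : 0 ≤ κ := Real.sqrt_nonneg _
  have hκM : (b - a) * κ ^ 2 = M ^ 2 := by
    rw [hκ, Real.sq_sqrt (by positivity)]
    field_simp
  set Vm := Real.sqrt (2 / (b - a) * M ^ 2 + 2 * (b - a) * M ^ 2) with hVm
  have hVm0 : 0 ≤ Vm := Real.sqrt_nonneg _
  set R := κ * ((b - a) + 3 * Real.sqrt (b - a)) with hR
  have hR0 : 0 ≤ R := by positivity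
  set K := 2 * (Vm + 2 * |β| * R ^ (2 * σ) + R) * κ with hK
  have hK0 : 0 ≤ K := by positivity
  set A := ((Vm + 2 * |β| * R ^ (2 * σ)) * (16 * κ + 2 * (b - a) * K) + 8 * K)
          + (4 * κ * (Vm + 2 * |β| * R ^ (2 * σ)) + 4 * K)
          + 4 * (Vm + |β| * R ^ (2 * σ)) ^ 2 * R with hA
  set E := Real.exp (|β| * R ^ (2 * σ) * T) * (4 * κ + T * A) with hE
  refine ⟨Real.sqrt ((b - a) * (7 * κ ^ 2 + E ^ 2)) + 1, by positivity, ?_⟩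
  intro V ψ hV hVM hψ hψM hsol τ N hτ hτ1 hN hh k hk
  have h0 := NLS.meshSize_nonneg hab.le N
  have hVB : NLS.IsPotentialBounded a b V Vm κ := by
    obtain ⟨Q, hQ, hI⟩ := hV.exists_hasEnergyDensity hab hVM
    refine ⟨hV.continuousOn, fun x hx => ?_, Q, hQ, hI.trans hκM.ge⟩
    apply Real.le_sqrt_of_sq_le
    rw [← Real.norm_eq_abs]
    refine (hQ.sq_norm_le hab hV.continuousOn hx).trans ?_
    have := NLS.integral_sq_norm_le_of_h1Norm_le hab.le hVM
    gcongr
  have hψB : ∀ t ∈ Set.Icc 0 T, NLS.IsH10Bounded a b (ψ t) κ := fun t ht => by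
    have hm := hψ.1 t ht
    obtain ⟨Q, hQ, hI⟩ := hm.toMemH1.exists_hasEnergyDensity hab (hψM t ht)
    exact ⟨hm.continuousOn, hm.left_eq_zero, hm.right_eq_zero, Q, hQ, hI.trans hκM.ge⟩
  have hψR : ∀ t ∈ Set.Icc 0 T, ∀ x ∈ Set.Icc a b, ‖ψ t x‖ ≤ R := fun t ht x hx =>
    ((hψB t ht).norm_le hab hκ0 hx).trans (by
      rw [hR, mul_comm]
      gcongr
      linarith [Real.sqrt_nonneg (b - a)])
  have hG : ∀ t ∈ Set.Icc 0 T, NLS.IsH10Bounded a b (NLS.fieldTerm β σ V (ψ t)) K := fun t ht =>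
    (hψB t ht).fieldTerm hab hσ_pos hσ_le hVB hVm0 hR0 (hψR t ht)
  have hkT : k * τ ≤ T := by rwa [le_div_iff₀ hτ] at hk
  rw [← Real.sqrt_eq_rpow]
  refine (NLS.l2Norm_sub_tssp_le hab hσ_pos hσ_le hN hκ0 hK0 hVm0 hT.le hR hh hVB hψB hG
    (fun t ht l => hsol.hasDerivWithinAt_fourierVec hab hψ.1 l ht) hA hE hτ.le hτ1.le hkT).trans ?_
  gcongr
  linarith
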